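/- **Theorem (Analytic splitting lemma).** Let $K=\mathbb{C}$ or $K=\mathbb{R}$ and let $K\{x\}=K\{x_1,\dots,x_n\}$ be the ring of convergent power series, i.e. of those $\sum_\alpha c_\alpha x^\alpha\in K[[x_1,\dots,x_n]]$ for which $\sum_\alpha |c_\alpha|\,\varepsilon^\alpha<\infty$ for some $\varepsilon\in(\mathbb{R}_{>0})^n$. Let $\mathfrak m=\langle x_1,\dots,x_n\rangle$ be its maximal ideal. Call $f,g\in K\{x\}$ *right equivalent*, $f\sim_r g$, if $\varphi(f)=g$ for some $K$-algebra automorphism $\varphi$ of $K\{x\}$ (an analytic coordinate change); right equivalence in the ring $K\{x_{k+1},\dots,x_n\}$ is defined in the same way. Let $f\in\mathfrak m^2\subset K\{x\}$, and let $k$ be the rank of its Hessian matrix $H(f)=\bigl(\frac{\partial^2 f}{\partial x_i\partial x_j}(0)\bigr)_{i,j=1,\dots,n}$. (It is not assumed that $f$ has an isolated singularity.) Then: 1. (Existence) There are $a_1,\dots,a_k\in K$, with $a_i=1$ for all $i$ if $K=\mathbb{C}$ and $a_i\in\{1,-1\}$ for all $i$ if $K=\mathbb{R}$, and a convergent power series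 $g\in\langle x_{k+1},\dots,x_n\rangle^3\subset K\{x_{k+1},\dots,x_n\}$ such that $$f\ \sim_r\ a_1x_1^2+\dots+a_kx_k^2+g(x_{k+1},\dots,x_n)\quad\text{in } K\{x_1,\dots,x_n\}.$$ 2. (Uniqueness) The residual part $g$ is unique up to right equivalence in $K\{x_{k+1},\dots,x_n\}$: if also $f\sim_r a_1'x_1^2+\dots+a_k'x_k^2+g'(x_{k+1},\dots,x_n)$ with coefficients $a_i'$ and a series $g'\in\langle x_{k+1},\dots,x_n\rangle^3\subset K\{x_{k+1},\dots,x_n\}$ as in 1., then $g\sim_r g'$ in $K\{x_{k+1},\dots,x_n\}$. -/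

import Mathlib

open MvPowerSeries

noncomputable section

namespace AnalyticSplitting

variable {K : Type*} [NormedField K] {σ τ : Type*}

/-- A formal power series `f = ∑ c_α x^α` over `K` is convergent if there are positive real numbers
`ε_i` with `∑ |c_α| ε^α < ∞`. -/
def IsConvergent (f : MvPowerSeries σ K) : Prop :=
  ∃ ε : σ → ℝ, (∀ i, 0 < ε i) ∧
    Summable fun α : σ →₀ ℕ => ‖coeff α f‖ * α.prod fun i m => ε i ^ m

theorem prod_pow_nonneg {ε : σ → ℝ} (hε : ∀ i, 0 < ε i) (α : σ →₀ ℕ) :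
    0 ≤ α.prod fun i m => ε i ^ m :=
  Finset.prod_nonneg fun i _ => pow_nonneg (hε i).le _

theorem summable_of_le {f : MvPowerSeries σ K} {ε δ : σ → ℝ} (hδ : ∀ i, 0 < δ i)
    (hle : ∀ i, δ i ≤ ε i)
    (h : Summable fun α : σ →₀ ℕ => ‖coeff α f‖ * α.prod fun i m => ε i ^ m) :
    Summable fun α : σ →₀ ℕ => ‖coeff α f‖ * α.prod fun i m => δ i ^ m := by
  refine Summable.of_nonneg_of_le
    (fun α => mul_nonneg (norm_nonneg _) (prod_pow_nonneg hδ α)) (fun α => ?_) h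
  refine mul_le_mul_of_nonneg_left ?_ (norm_nonneg _)
  exact Finset.prod_le_prod (fun i _ => pow_nonneg (hδ i).le _)
    fun i _ => pow_le_pow_left₀ (hδ i).le (hle i) _

theorem IsConvergent.common {f g : MvPowerSeries σ K} (hf : IsConvergent f)
    (hg : IsConvergent g) : ∃ ε : σ → ℝ, (∀ i, 0 < ε i) ∧
      (Summable fun α : σ →₀ ℕ => ‖coeff α f‖ * α.prod fun i m => ε i ^ m) ∧
      Summable fun α : σ →₀ ℕ => ‖coeff α g‖ * α.prod fun i m => ε i ^ m := by
  obtain ⟨ε, hε, hf⟩ := hf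
  obtain ⟨δ, hδ, hg⟩ := hg
  have hpos : ∀ i, 0 < min (ε i) (δ i) := fun i => lt_min (hε i) (hδ i)
  exact ⟨fun i => min (ε i) (δ i), hpos, summable_of_le hpos (fun i => min_le_left _ _) hf,
    summable_of_le hpos (fun i => min_le_right _ _) hg⟩

theorem IsConvergent.add {f g : MvPowerSeries σ K} (hf : IsConvergent f) (hg : IsConvergent g) :
    IsConvergent (f + g) := by
  obtain ⟨ε, hε, hf, hg⟩ := hf.common hg
  refine ⟨ε, hε, Summable.of_nonneg_of_le
    (fun α => mul_nonneg (norm_nonneg _) (prod_pow_nonneg hε α)) (fun α => ?_) (hf.add hg)⟩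
  rw [map_add, ← add_mul]
  exact mul_le_mul_of_nonneg_right (norm_add_le _ _) (prod_pow_nonneg hε α)

theorem norm_coeff_mul_le [DecidableEq σ] (f g : MvPowerSeries σ K) {ε : σ → ℝ}
    (hε : ∀ i, 0 < ε i) (α : σ →₀ ℕ) :
    ‖coeff α (f * g)‖ * (α.prod fun i m => ε i ^ m) ≤
      ∑ p ∈ Finset.HasAntidiagonal.antidiagonal α, (‖coeff p.1 f‖ * p.1.prod fun i m => ε i ^ m) *
        (‖coeff p.2 g‖ * p.2.prod fun i m => ε i ^ m) := by
  rw [coeff_mul]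
  refine (mul_le_mul_of_nonneg_right (norm_sum_le _ _) (prod_pow_nonneg hε α)).trans (le_of_eq ?_)
  rw [Finset.sum_mul]
  refine Finset.sum_congr rfl fun p hp => ?_
  have h : (α.prod fun i m => ε i ^ m) =
      (p.1.prod fun i m => ε i ^ m) * p.2.prod fun i m => ε i ^ m := by
    rw [← Finset.HasAntidiagonal.mem_antidiagonal.mp hp]
    exact Finsupp.prod_add_index' (fun _ => pow_zero _) (fun _ _ _ => pow_add _ _ _)
  rw [h, norm_mul, mul_mul_mul_comm]

theorem norm_term_nonneg (f : MvPowerSeries σ K) {ε : σ → ℝ} (hε : ∀ i, 0 < ε i) :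
    0 ≤ fun α : σ →₀ ℕ => ‖coeff α f‖ * α.prod fun i m => ε i ^ m :=
  fun α => mul_nonneg (norm_nonneg _) (prod_pow_nonneg hε α)

theorem summable_antidiagonal {A : Type*} [AddCommMonoid A] [Finset.HasAntidiagonal A]
    {u v : A → ℝ} (hu : Summable u) (hv : Summable v) (hu0 : 0 ≤ u) (hv0 : 0 ≤ v) :
    Summable fun a => ∑ p ∈ Finset.HasAntidiagonal.antidiagonal a, u p.1 * v p.2 :=
  summable_sum_mul_antidiagonal_of_summable_mul (hu.mul_of_nonneg hv hu0 hv0)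

theorem IsConvergent.mul {f g : MvPowerSeries σ K} (hf : IsConvergent f) (hg : IsConvergent g) :
    IsConvergent (f * g) := by
  classical
  obtain ⟨ε, hε, hf, hg⟩ := hf.common hg
  refine ⟨ε, hε, ?_⟩
  have hsum := summable_antidiagonal hf hg (norm_term_nonneg f hε) (norm_term_nonneg g hε)
  exact Summable.of_nonneg_of_le (norm_term_nonneg (f * g) hε) (norm_coeff_mul_le f g hε) hsum

theorem isConvergent_of_finite {f : MvPowerSeries σ K} (h : {α | coeff α f ≠ 0}.Finite) :
    IsConvergent f := by
  refine ⟨fun _ => 1, fun _ => one_pos, summable_of_hasFiniteSupport (h.subset fun α hα h0 => ?_)⟩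
  exact hα (by simp [h0])

theorem isConvergent_monomial (α : σ →₀ ℕ) (c : K) : IsConvergent (monomial α c) := by
  classical
  refine isConvergent_of_finite ((Set.finite_singleton α).subset fun β hβ => ?_)
  by_contra hne
  exact hβ (by rw [coeff_monomial, if_neg (fun h => hne (Set.mem_singleton_iff.mpr h))])

/-- The ring `K⟨x⟩` of convergent power series in the variables `x_i`, `i ∈ σ`, as a `K`-subalgebra
of the ring of formal power series. -/
def Conv (σ K : Type*) [NormedField K] : Subalgebra K (MvPowerSeries σ K) where
  carrier := {f | IsConvergent f}
  mul_mem' := IsConvergent.mul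
  add_mem' := IsConvergent.add
  algebraMap_mem' c := isConvergent_monomial 0 c

namespace Conv

/-- The variable `x_i` as a convergent power series. -/
def X (i : σ) : Conv σ K := ⟨MvPowerSeries.X i, isConvergent_monomial _ _⟩

/-- The maximal ideal `𝔪 = ⟨x_i : i ∈ σ⟩` of the ring of convergent power series. -/
def maxIdeal (σ K : Type*) [NormedField K] : Ideal (Conv σ K) := Ideal.span (Set.range X)

/-- The Hessian matrix `(∂²f/∂x_i∂x_j (0))_{i,j}`. -/
def hessian (f : Conv σ K) : Matrix σ σ K :=
  Matrix.of fun i j =>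
    constantCoeff (MvPowerSeries.pderiv K i (MvPowerSeries.pderiv K j (f : MvPowerSeries σ K)))

/-- Right equivalence: `f` is mapped to `g` by an analytic coordinate change, i.e. by an
automorphism of the `K`-algebra of convergent power series (which is automatically local). -/
def RightEquiv (f g : Conv σ K) : Prop :=
  ∃ φ : Conv σ K ≃ₐ[K] Conv σ K, φ f = g

end Conv

theorem IsConvergent.rename (e : σ ↪ τ) {f : MvPowerSeries σ K} (hf : IsConvergent f) :
    IsConvergent (MvPowerSeries.rename e f) := by
  classical
  obtain ⟨ε, hε, hf⟩ := hf
  refine ⟨Function.extend e ε 1, fun j => ?_, ?_⟩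
  · by_cases hj : ∃ i, e i = j
    · obtain ⟨i, rfl⟩ := hj
      rw [e.injective.extend_apply]
      exact hε i
    · rw [Function.extend_apply' _ _ _ hj]
      exact one_pos
  · rw [← (Finsupp.embDomain_injective (M := ℕ) e).summable_iff]
    · refine hf.congr fun α => ?_
      rw [Function.comp_apply, coeff_embDomain_rename, Finsupp.prod_embDomain]
      simp only [e.injective.extend_apply]
    · intro β hβ
      rw [coeff_rename_eq_zero, norm_zero, zero_mul]
      rintro ⟨α, rfl⟩
      exact hβ ⟨α, Finsupp.embDomain_eq_mapDomain e α⟩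

namespace Conv

/-- The inclusion of the ring of convergent power series in some of the variables into the ring of
convergent power series in all the variables. -/
def incl (e : σ ↪ τ) : Conv σ K →ₐ[K] Conv τ K :=
  ((MvPowerSeries.rename e).comp (Conv σ K).val).codRestrict (Conv τ K)
    fun f => IsConvergent.rename e f.2

/-- The power series `a_1 x_1² + ⋯ + a_k x_k² + g(x_{k+1}, …, x_n)`. The variables are indexed by
`Fin n`, so that `x_1, …, x_k` have the indices `i < k` and `x_{k+1}, …, x_n` the indices
`i ≥ k`. -/
def splitForm {n k : ℕ} (a : {i : Fin n // (i : ℕ) < k} → K)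
    (g : Conv {i : Fin n // k ≤ (i : ℕ)} K) : Conv (Fin n) K :=
  ∑ i, a i • X (i : Fin n) ^ 2 + incl (Function.Embedding.subtype _) g

end Conv

end AnalyticSplitting

end

noncomputable section

namespace AnalyticSplitting

namespace Conv

/-! ### Formal calculus at the origin: values, linear parts, Hessians, division by variables. -/

section Algebra

variable {K : Type*} [NormedField K] {σ τ ι : Type*}

/-! Convergent series are treated as germs of analytic functions at 0: `eval` respects sums and
products near 0, is injective (`eq_of_eval_eventuallyEq`) and reaches every analytic germ
(`exists_eval_eq_of_analyticAt`). So substitution is composition, and the analytic inverse function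
theorem gives `exists_algEquiv_of_isUnit_det` and then `exists_implicit`. The nonlinear coordinate
changes below are built from solutions of implicit equations.

Existence. A linear change brings f to Σ a_i x_i² + h(x,y) with h of order three. The equations
∂f/∂x_i = 0 have a solution x = v(y); translating by v kills the terms linear in x and leaves Σ a_i
x_i² + g(y) + Σ x_i x_j E_ij(x,y) with E_ij(0) = 0 (`exists_shift`). This is a quadratic form in x
whose coefficients vary near the nondegenerate form diag(a); a substitution linear in x, with matrix
depending on (x,y), carries diag(a) to it (`exists_complete_square`).

Uniqueness (`rightEquiv_residual`). Suppose an automorphism x ↦ A, y ↦ B gives Σ a_i A_i² + g(B) = Σ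
a'_i x_i² + g'(y). Put β(y) = B(0,y). Comparing Hessians, the A_i have no linear terms in y, so β is
a coordinate change. Setting x = 0 gives g' = g(β) + Σ a_i A_i(0,y)². Differentiating in x along x =
0 gives an invertible linear system that expresses A_i(0,y) through the (∂g/∂y_l)(β). Hence, after
undoing β, g' differs from g by an element of the square of the Jacobian ideal of g. Such a change
is absorbed by a substitution y_l ↦ y_l + Σ w_lm ∂g/∂y_m, where w solves an implicit equation
(`rightEquiv_add_sum_mul`). No finiteness of the singularity enters. -/

@[simp] theorem coe_X (i : σ) : ((X i : Conv σ K) : MvPowerSeries σ K) = MvPowerSeries.X i := rfl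

theorem ext_coeff {f g : Conv σ K}
    (h : ∀ α, coeff α (f : MvPowerSeries σ K) = coeff α (g : MvPowerSeries σ K)) : f = g :=
  Subtype.ext (MvPowerSeries.ext h)

/-- The value at the origin. -/
def valZero : Conv σ K →ₐ[K] K where
  toRingHom := (constantCoeff (σ := σ) (R := K)).comp (Conv σ K).subtype
  commutes' c := constantCoeff_C (σ := σ) c

theorem valZero_apply (f : Conv σ K) :
    valZero f = constantCoeff (f : MvPowerSeries σ K) := rfl

@[simp] theorem valZero_X (i : σ) : valZero (X i : Conv σ K) = 0 := constantCoeff_X i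

/-- The coefficient of the linear monomial `x_j`, i.e. the value of `∂f/∂x_j` at the origin. -/
def lin (j : σ) : Conv σ K →ₗ[K] K :=
  (coeff (R := K) (Finsupp.single j 1)).comp (Conv σ K).val.toLinearMap

theorem lin_apply (j : σ) (f : Conv σ K) :
    lin j f = coeff (Finsupp.single j 1) (f : MvPowerSeries σ K) := rfl

theorem lin_eq_constantCoeff_pderiv (j : σ) (f : Conv σ K) :
    lin j f = constantCoeff (pderiv K j (f : MvPowerSeries σ K)) := by
  rw [← coeff_zero_eq_constantCoeff_apply, coeff_pderiv, lin_apply]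
  simp

theorem lin_mul (j : σ) (f g : Conv σ K) :
    lin j (f * g) = valZero f * lin j g + valZero g * lin j f := by
  simp [lin_eq_constantCoeff_pderiv, valZero_apply]

@[simp] theorem lin_X [DecidableEq σ] (i j : σ) :
    lin j (X i : Conv σ K) = if j = i then 1 else 0 := by
  rw [lin_apply, coe_X, coeff_index_single_X]

@[simp] theorem lin_algebraMap (j : σ) (c : K) : lin j (algebraMap K (Conv σ K) c) = 0 := by
  rw [lin_eq_constantCoeff_pderiv]
  change constantCoeff (pderiv K j (C c)) = 0
  simp

theorem hessian_apply (f : Conv σ K) (i j : σ) : hessian f i j =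
    constantCoeff (pderiv K i (pderiv K j (f : MvPowerSeries σ K))) := rfl

theorem hessian_add (f g : Conv σ K) : hessian (f + g) = hessian f + hessian g := by
  ext i j
  simp [hessian_apply]

theorem hessian_mul_of_valZero {f g : Conv σ K} (hf : valZero f = 0) (hg : valZero g = 0)
    (i j : σ) :
    hessian (f * g) i j = lin i f * lin j g + lin j f * lin i g := by
  rw [valZero_apply] at hf hg
  simp [hessian_apply, lin_eq_constantCoeff_pderiv, hf, hg]
  ring

theorem hessian_smul (c : K) (f : Conv σ K) : hessian (c • f) = c • hessian f := by
  ext i j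
  simp [hessian_apply]

theorem hessian_sum {κ : Type*} (s : Finset κ) (f : κ → Conv σ K) :
    hessian (∑ i ∈ s, f i) = ∑ i ∈ s, hessian (f i) := by
  classical
  induction s using Finset.induction_on with
  | empty => ext i j; simp [hessian_apply]
  | insert a s ha ih => rw [Finset.sum_insert ha, Finset.sum_insert ha, hessian_add, ih]

theorem hessian_eq_zero_of_coeff {f : Conv σ K}
    (h : ∀ α : σ →₀ ℕ, α.degree < 3 → coeff α (f : MvPowerSeries σ K) = 0) : hessian f = 0 := by
  ext i j
  rw [hessian_apply, ← coeff_zero_eq_constantCoeff_apply, coeff_pderiv, coeff_pderiv, h]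
  · simp
  · simp [Finsupp.degree_single]

/-- For a monomial divisible by some variable from `s`, a choice of such a variable. -/
def divisor (s : Finset σ) (β : σ →₀ ℕ) : Option σ :=
  open Classical in if h : ∃ i ∈ s, β i ≠ 0 then some h.choose else none

theorem divisor_eq_some {s : Finset σ} {β : σ →₀ ℕ} {i : σ} (h : divisor s β = some i) :
    i ∈ s ∧ β i ≠ 0 := by
  unfold divisor at h
  split_ifs at h with h'
  cases h
  exact h'.choose_spec

theorem divisor_isSome {s : Finset σ} {β : σ →₀ ℕ} (h : ∃ i ∈ s, β i ≠ 0) :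
    ∃ i, divisor s β = some i := by
  unfold divisor
  rw [dif_pos h]
  exact ⟨_, rfl⟩

theorem divisor_eq_none {s : Finset σ} {β : σ →₀ ℕ} (h : ∀ i ∈ s, β i = 0) :
    divisor s β = none := by
  unfold divisor
  rw [dif_neg]
  rintro ⟨i, hi, hi'⟩
  exact hi' (h i hi)

/-- The cofactor of `x_i` when a series is divided by the variables from `s`. -/
def quotSeries (s : Finset σ) (f : MvPowerSeries σ K) (i : σ) : MvPowerSeries σ K :=
  fun α => open Classical in
    if divisor s (α + Finsupp.single i 1) = some i then coeff (α + Finsupp.single i 1) f else 0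

theorem coeff_quotSeries [DecidableEq σ] (s : Finset σ) (f : MvPowerSeries σ K) (i : σ)
    (α : σ →₀ ℕ) : coeff α (quotSeries s f i) =
    if divisor s (α + Finsupp.single i 1) = some i then coeff (α + Finsupp.single i 1) f else 0 := by
  rw [coeff_apply, quotSeries]
  congr

/-- The coefficients are shifted coefficients of f or zero, so the same polyradius works, at the
cost of a factor ε_i⁻¹. -/
theorem isConvergent_quotSeries (s : Finset σ) {f : MvPowerSeries σ K} (hf : IsConvergent f)
    (i : σ) : IsConvergent (quotSeries s f i) := by
  classical
  obtain ⟨ε, hε, hs⟩ := hf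
  refine ⟨ε, hε, ?_⟩
  have hinj : Function.Injective fun α : σ →₀ ℕ => α + Finsupp.single i 1 :=
    add_left_injective _
  refine Summable.of_nonneg_of_le (norm_term_nonneg _ hε) (fun α => ?_)
    ((hs.comp_injective hinj).mul_left (ε i)⁻¹)
  have h1 : ((α + Finsupp.single i 1).prod fun i m => ε i ^ m)
      = (α.prod fun i m => ε i ^ m) * ε i := by
    rw [Finsupp.prod_add_index' (fun _ => pow_zero _) (fun _ _ _ => pow_add _ _ _)]
    simp
  have h2 : ‖coeff α (quotSeries s f i)‖ ≤ ‖coeff (α + Finsupp.single i 1) f‖ := by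
    rw [coeff_quotSeries]
    split_ifs
    · exact le_rfl
    · rw [norm_zero]; exact norm_nonneg _
  simp only [Function.comp_apply, h1]
  have h3 := hε i
  calc _ ≤ ‖coeff (α + Finsupp.single i 1) f‖ * (α.prod fun i m => ε i ^ m) :=
        mul_le_mul_of_nonneg_right h2 (prod_pow_nonneg hε α)
    _ = _ := by field_simp

theorem coeff_X_mul [DecidableEq σ] (i : σ) (f : MvPowerSeries σ K) (β : σ →₀ ℕ) :
    coeff β (MvPowerSeries.X i * f) =
      if β i ≠ 0 then coeff (β - Finsupp.single i 1) f else 0 := by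
  rw [X_def, coeff_monomial_mul]
  simp [Nat.one_le_iff_ne_zero]

/-- Division by some of the variables. -/
theorem exists_division (s : Finset σ) (f : Conv σ K) :
    ∃ q : σ → Conv σ K,
      (∀ i α, coeff α (q i : MvPowerSeries σ K) = 0 ∨
        coeff α (q i : MvPowerSeries σ K) =
          coeff (α + Finsupp.single i 1) (f : MvPowerSeries σ K)) ∧
      (∀ α, (∀ i ∈ s, α i = 0) → coeff α ((f - ∑ i ∈ s, X i * q i : Conv σ K) : MvPowerSeries σ K)
        = coeff α (f : MvPowerSeries σ K)) ∧
      (∀ α, (∃ i ∈ s, α i ≠ 0) →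
        coeff α ((f - ∑ i ∈ s, X i * q i : Conv σ K) : MvPowerSeries σ K) = 0) := by
  classical
  -- A monomial divisible by a variable from s is assigned to exactly one of them, its `divisor`, so
  -- the products x_i q_i have disjoint supports.
  have key : ∀ (i : σ) (β : σ →₀ ℕ),
      coeff β (MvPowerSeries.X i * quotSeries s (f : MvPowerSeries σ K) i) =
      if divisor s β = some i then coeff β (f : MvPowerSeries σ K) else 0 := by
    intro i β
    rw [coeff_X_mul]
    by_cases h : β i = 0
    · rw [if_neg (by simpa using h), if_neg]
      exact fun h' => (divisor_eq_some h').2 h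
    · rw [if_pos h, coeff_quotSeries]
      have : β - Finsupp.single i 1 + Finsupp.single i 1 = β :=
        tsub_add_cancel_of_le (by simpa [Nat.one_le_iff_ne_zero] using h)
      rw [this]
  refine ⟨fun i => ⟨quotSeries s f i, isConvergent_quotSeries s f.2 i⟩, fun i α => ?_,
    fun α hα => ?_, fun α hα => ?_⟩
  · change coeff α (quotSeries s _ i) = 0 ∨ coeff α (quotSeries s _ i) = _
    rw [coeff_quotSeries]
    split_ifs
    · exact Or.inr rfl
    · exact Or.inl rfl
  · have : ∀ i ∈ s, coeff α (MvPowerSeries.X i * quotSeries s (f : MvPowerSeries σ K) i) = 0 := by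
      intro i _
      rw [key, divisor_eq_none hα, if_neg (by simp)]
    simp [Finset.sum_eq_zero this]
  · obtain ⟨i, hi⟩ := divisor_isSome hα
    have : ∑ j ∈ s, coeff α (MvPowerSeries.X j * quotSeries s (f : MvPowerSeries σ K) j)
        = coeff α (f : MvPowerSeries σ K) := by
      rw [Finset.sum_eq_single i]
      · rw [key, if_pos hi]
      · intro j _ hj
        rw [key, hi, if_neg]
        simpa using hj.symm
      · exact fun h => absurd (divisor_eq_some hi).1 h
    simp [this]

/-- Induction on N: dividing by all the variables lowers the order of the cofactors by one. -/
theorem mem_maxIdeal_pow_of_coeff [Fintype σ] (N : ℕ) : ∀ f : Conv σ K,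
    (∀ α : σ →₀ ℕ, α.degree < N → coeff α (f : MvPowerSeries σ K) = 0) →
      f ∈ maxIdeal σ K ^ N := by
  induction N with
  | zero => simp
  | succ N ih =>
    intro f hf
    obtain ⟨q, hq, h0, h1⟩ := exists_division Finset.univ f
    have hfq : f = ∑ i, X i * q i := by
      rw [← sub_eq_zero]
      refine ext_coeff fun α => ?_
      by_cases hα : ∀ i, α i = 0
      · rw [h0 α fun i _ => hα i, hf α]
        · rfl
        · have : α = 0 := Finsupp.ext hα
          simp [this]
      · push Not at hα
        rw [h1 α (by simpa using hα)]
        rfl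
    rw [hfq, pow_succ']
    refine Ideal.sum_mem _ fun i _ => Ideal.mul_mem_mul (Ideal.subset_span ⟨i, rfl⟩) (ih _ ?_)
    intro α hα
    rcases hq i α with h | h
    · exact h
    · rw [h]
      apply hf
      simpa [Finsupp.degree_single] using hα

theorem valZero_eq_zero_of_mem {f : Conv σ K} (hf : f ∈ maxIdeal σ K) : valZero f = 0 := by
  have : maxIdeal σ K ≤ RingHom.ker (valZero : Conv σ K →ₐ[K] K) := by
    rw [maxIdeal, Ideal.span_le]
    rintro _ ⟨i, rfl⟩
    exact valZero_X i
  exact this hf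

theorem coeff_eq_zero_of_mem_pow (N : ℕ) : ∀ f ∈ maxIdeal σ K ^ N,
    ∀ α : σ →₀ ℕ, α.degree < N → coeff α (f : MvPowerSeries σ K) = 0 := by
  classical
  induction N with
  | zero => simp
  | succ N ih =>
    intro f hf
    rw [pow_succ'] at hf
    refine Submodule.mul_induction_on hf ?_ ?_
    · intro a ha b hb α hα
      change coeff α ((a : MvPowerSeries σ K) * (b : MvPowerSeries σ K)) = 0
      rw [coeff_mul]
      refine Finset.sum_eq_zero fun p hp => ?_
      rw [Finset.HasAntidiagonal.mem_antidiagonal] at hp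
      by_cases h : p.1 = 0
      · have := valZero_eq_zero_of_mem ha
        rw [h, coeff_zero_eq_constantCoeff_apply, ← valZero_apply, this, zero_mul]
      · have h1 : p.1.degree ≠ 0 := by rwa [Ne, Finsupp.degree_eq_zero_iff]
        rw [ih b hb, mul_zero]
        have : p.1.degree + p.2.degree = α.degree := by rw [← hp, map_add]
        omega
    · intro a b ha hb α hα
      change coeff α ((a : MvPowerSeries σ K) + (b : MvPowerSeries σ K)) = 0
      rw [map_add, ha α hα, hb α hα, add_zero]

theorem mem_maxIdeal_pow_iff [Fintype σ] {N : ℕ} {f : Conv σ K} : f ∈ maxIdeal σ K ^ N ↔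
    ∀ α : σ →₀ ℕ, α.degree < N → coeff α (f : MvPowerSeries σ K) = 0 :=
  ⟨coeff_eq_zero_of_mem_pow N f, mem_maxIdeal_pow_of_coeff N f⟩

theorem mem_maxIdeal_iff [Fintype σ] {f : Conv σ K} : f ∈ maxIdeal σ K ↔ valZero f = 0 := by
  refine ⟨valZero_eq_zero_of_mem, fun h => ?_⟩
  rw [← pow_one (maxIdeal σ K), mem_maxIdeal_pow_iff]
  intro α hα
  have : α = 0 := by rw [← Finsupp.degree_eq_zero_iff]; omega
  rw [this, coeff_zero_eq_constantCoeff_apply]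
  exact h

theorem hessian_eq_zero_of_mem {f : Conv σ K} (hf : f ∈ maxIdeal σ K ^ 3) : hessian f = 0 :=
  hessian_eq_zero_of_coeff (coeff_eq_zero_of_mem_pow 3 f hf)

theorem lin_eq_zero_of_mem {f : Conv σ K} (hf : f ∈ maxIdeal σ K ^ 2) (j : σ) : lin j f = 0 :=
  coeff_eq_zero_of_mem_pow 2 f hf _ (by simp [Finsupp.degree_single])

/-- Division with remainder the constant term. -/
theorem exists_eq_sum_X_mul [Fintype σ] (f : Conv σ K) :
    ∃ q : σ → Conv σ K, f = algebraMap K _ (valZero f) + ∑ i, X i * q i ∧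
      ∀ N, f ∈ maxIdeal σ K ^ (N + 1) → ∀ i, q i ∈ maxIdeal σ K ^ N := by
  classical
  obtain ⟨q, hq, h0, h1⟩ := exists_division Finset.univ f
  refine ⟨q, ?_, fun N hN i => ?_⟩
  · rw [← sub_eq_iff_eq_add]
    refine ext_coeff fun α => ?_
    change _ = coeff α (C (valZero f))
    by_cases hα : ∀ i, α i = 0
    · have hα0 : α = 0 := Finsupp.ext hα
      rw [h0 α fun i _ => hα i, hα0]
      exact (coeff_zero_C _).symm
    · push Not at hα
      rw [h1 α (by simpa using hα), coeff_C, if_neg]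
      rintro rfl
      simp at hα
  · rw [mem_maxIdeal_pow_iff] at hN ⊢
    intro α hα
    rcases hq i α with h | h
    · exact h
    · rw [h]
      apply hN
      simpa [Finsupp.degree_single] using hα

/-- Setting the variables outside the range of `e` to zero. -/
def res (e : σ ↪ τ) : Conv τ K →ₐ[K] Conv σ K :=
  ((killCompl e).comp (Conv τ K).val).codRestrict (Conv σ K) fun f => by
    obtain ⟨ε, hε, hs⟩ := f.2
    refine ⟨ε ∘ e, fun i => hε _, ?_⟩
    refine (hs.comp_injective (Finsupp.embDomain_injective e)).congr fun α => ?_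
    simp only [Function.comp_apply, Finsupp.prod_embDomain]
    rfl

theorem coeff_res (e : σ ↪ τ) (f : Conv τ K) (α : σ →₀ ℕ) :
    coeff α (res e f : MvPowerSeries σ K) =
      coeff (Finsupp.embDomain e α) (f : MvPowerSeries τ K) := coeff_killCompl _ _

theorem coeff_incl (e : σ ↪ τ) (f : Conv σ K) (α : σ →₀ ℕ) :
    coeff (Finsupp.embDomain e α) (incl e f : MvPowerSeries τ K) =
      coeff α (f : MvPowerSeries σ K) := coeff_embDomain_rename _ _ _

@[simp] theorem res_incl (e : σ ↪ τ) (f : Conv σ K) : res e (incl e f) = f :=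
  ext_coeff fun α => by rw [coeff_res, coeff_incl]

@[simp] theorem incl_X (e : σ ↪ τ) (i : σ) : incl e (X i : Conv σ K) = X (e i) :=
  Subtype.ext (rename_X (e : σ → τ) i)

@[simp] theorem res_X (e : σ ↪ τ) (i : σ) : res e (X (e i) : Conv τ K) = X i := by
  rw [← incl_X, res_incl]

theorem res_X_eq_zero (e : σ ↪ τ) {i : τ} (h : i ∉ Set.range e) :
    res e (X i : Conv τ K) = 0 := Subtype.ext (killCompl_X_eq_zero h)

end Algebra

/-! ### Words in the variables, linking multi-indices with multilinear maps. -/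

section Words

variable {σ : Type*}

/-- The multi-index of a word in the variables. -/
def content (w : Σ m : ℕ, Fin m → σ) : σ →₀ ℕ := ∑ j, Finsupp.single (w.2 j) 1

theorem degree_content (w : Σ m : ℕ, Fin m → σ) : (content w).degree = w.1 := by
  simp [content, map_sum, Finsupp.degree_single]

theorem content_cons {m : ℕ} (i : σ) (s : Fin m → σ) :
    content ⟨m + 1, Fin.cons i s⟩ = Finsupp.single i 1 + content ⟨m, s⟩ := by
  simp [content, Fin.sum_univ_succ]

theorem content_surjective :
    Function.Surjective (content : (Σ m : ℕ, Fin m → σ) → (σ →₀ ℕ)) := by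
  suffices h : ∀ (m : ℕ) (α : σ →₀ ℕ), α.degree = m → ∃ w, content w = α from
    fun α => h _ α rfl
  intro m
  induction m with
  | zero =>
    intro α hα
    refine ⟨⟨0, Fin.elim0⟩, ?_⟩
    rw [Finsupp.degree_eq_zero_iff] at hα
    simp [content, hα]
  | succ m ih =>
    intro α hα
    have h0 : α ≠ 0 := by
      rintro rfl
      simp at hα
    obtain ⟨i, hi⟩ := Finsupp.ne_iff.mp h0
    have hle : Finsupp.single i 1 ≤ α := by simpa [Nat.one_le_iff_ne_zero] using hi
    obtain ⟨β, rfl⟩ := exists_add_of_le hle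
    rw [map_add, Finsupp.degree_single] at hα
    obtain ⟨⟨k, s⟩, hs⟩ := ih β (by omega)
    exact ⟨⟨k + 1, Fin.cons i s⟩, by rw [content_cons, hs]⟩

/-- The monomial function `x ↦ x^α`. -/
def monom {M : Type*} [CommMonoid M] (x : σ → M) (α : σ →₀ ℕ) : M := α.prod fun i m => x i ^ m

theorem monom_add {M : Type*} [CommMonoid M] (x : σ → M) (α β : σ →₀ ℕ) :
    monom x (α + β) = monom x α * monom x β :=
  Finsupp.prod_add_index' (fun _ => pow_zero _) (fun _ _ _ => pow_add _ _ _)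

theorem monom_single {M : Type*} [CommMonoid M] (x : σ → M) (i : σ) :
    monom x (Finsupp.single i 1) = x i := by simp [monom]

theorem monom_zero {M : Type*} [CommMonoid M] (x : σ → M) : monom x 0 = 1 := by
  simp [monom]

theorem monom_const {M : Type*} [CommMonoid M] (r : M) (α : σ →₀ ℕ) :
    monom (fun _ : σ => r) α = r ^ α.degree := by
  rw [monom, Finsupp.prod, Finset.prod_pow_eq_pow_sum, Finsupp.degree_apply]

theorem monom_content {M : Type*} [CommMonoid M] (x : σ → M) (w : Σ m : ℕ, Fin m → σ) :
    monom x (content w) = ∏ j, x (w.2 j) := by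
  obtain ⟨m, s⟩ := w
  induction m with
  | zero => simp [content, monom_zero]
  | succ m ih =>
    obtain ⟨i, s, rfl⟩ : ∃ i s', s = Fin.cons i s' := ⟨s 0, Fin.tail s, (Fin.cons_self_tail s).symm⟩
    rw [content_cons, monom_add, monom_single, ih]
    simp [Fin.prod_univ_succ]

theorem norm_monom_le [Fintype σ] {K : Type*} [NormedField K] {r : ℝ} {x : σ → K} (hx : ‖x‖ ≤ r)
    (α : σ →₀ ℕ) : ‖monom x α‖ ≤ r ^ α.degree := by
  rw [← monom_const, monom, Finsupp.prod, norm_prod]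
  refine Finset.prod_le_prod (fun _ _ => norm_nonneg _) fun i _ => ?_
  rw [norm_pow]
  exact pow_le_pow_left₀ (norm_nonneg _) ((norm_le_pi_norm x i).trans hx) _

/-- The letters of a word as a multilinear form. -/
def wordForm (K : Type*) [NontriviallyNormedField K] [Fintype σ] {m : ℕ} (s : Fin m → σ) :
    ContinuousMultilinearMap K (fun _ : Fin m => σ → K) K :=
  (ContinuousMultilinearMap.mkPiAlgebra K (Fin m) K).compContinuousLinearMap
    fun j => ContinuousLinearMap.proj (s j)

theorem wordForm_apply (K : Type*) [NontriviallyNormedField K] [Fintype σ] {m : ℕ} (s : Fin m → σ)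
    (v : Fin m → σ → K) : wordForm K s v = ∏ j, v j (s j) := by
  simp [wordForm]

theorem norm_wordForm_le (K : Type*) [NontriviallyNormedField K] [Fintype σ] {m : ℕ}
    (s : Fin m → σ) : ‖wordForm K s‖ ≤ 1 := by
  refine ContinuousMultilinearMap.opNorm_le_bound zero_le_one fun v => ?_
  rw [wordForm_apply, norm_prod, one_mul]
  exact Finset.prod_le_prod (fun _ _ => norm_nonneg _) fun j _ => norm_le_pi_norm _ _

end Words

/-! ### Convergent power series as germs of analytic functions. -/

section Germs

variable {K : Type*} [NontriviallyNormedField K] {σ τ : Type*}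

theorem exists_radius [Fintype σ] {f : MvPowerSeries σ K} (hf : IsConvergent f) :
    ∃ r : ℝ, 0 < r ∧ Summable fun α : σ →₀ ℕ => ‖coeff α f‖ * r ^ α.degree := by
  obtain ⟨ε, hε, hs⟩ := hf
  obtain ⟨r, hr, hrε⟩ : ∃ r : ℝ, 0 < r ∧ ∀ i, r ≤ ε i := by
    rcases isEmpty_or_nonempty σ with h | h
    · exact ⟨1, one_pos, fun i => h.elim i⟩
    · obtain ⟨i, hi⟩ := Finite.exists_min ε
      exact ⟨ε i, hε i, hi⟩
  refine ⟨r, hr, (summable_of_le (fun _ => hr) hrε hs).congr fun α => ?_⟩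
  rw [← monom_const, monom]

/-- The sum of a convergent power series. -/
def eval (f : Conv σ K) (x : σ → K) : K :=
  ∑' α : σ →₀ ℕ, coeff α (f : MvPowerSeries σ K) * monom x α

theorem eventually_summable [Fintype σ] (f : Conv σ K) : ∀ᶠ x in nhds (0 : σ → K),
    Summable fun α : σ →₀ ℕ => ‖coeff α (f : MvPowerSeries σ K) * monom x α‖ := by
  obtain ⟨r, hr, hs⟩ := exists_radius f.2
  filter_upwards [Metric.closedBall_mem_nhds (0 : σ → K) hr] with x hx
  rw [mem_closedBall_zero_iff] at hx
  refine Summable.of_nonneg_of_le (fun _ => norm_nonneg _) (fun α => ?_) hs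
  rw [norm_mul]
  exact mul_le_mul_of_nonneg_left (norm_monom_le hx α) (norm_nonneg _)

theorem eval_add [Fintype σ] [CompleteSpace K] (f g : Conv σ K) : eval (f + g) =ᶠ[nhds 0] eval f + eval g := by
  filter_upwards [eventually_summable f, eventually_summable g] with x hf hg
  rw [Pi.add_apply, eval, eval, eval, ← hf.of_norm.tsum_add hg.of_norm]
  refine tsum_congr fun α => ?_
  rw [← add_mul]
  rfl

theorem coeff_mul_mul_monom [DecidableEq σ] (f g : MvPowerSeries σ K) (x : σ → K) (α : σ →₀ ℕ) :
    coeff α (f * g) * monom x α = ∑ p ∈ Finset.HasAntidiagonal.antidiagonal α,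
      (coeff p.1 f * monom x p.1) * (coeff p.2 g * monom x p.2) := by
  rw [coeff_mul, Finset.sum_mul]
  refine Finset.sum_congr rfl fun p hp => ?_
  rw [← Finset.HasAntidiagonal.mem_antidiagonal.mp hp, monom_add, mul_mul_mul_comm]

theorem tsum_mul_eq_tsum_antidiagonal {A : Type*} [AddCommMonoid A] [Finset.HasAntidiagonal A]
    [CompleteSpace K] {u v : A → K} (hu : Summable fun a => ‖u a‖) (hv : Summable fun a => ‖v a‖) :
    (∑' a, u a) * ∑' a, v a =
      ∑' a, ∑ p ∈ Finset.HasAntidiagonal.antidiagonal a, u p.1 * v p.2 :=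
  hu.of_norm.tsum_mul_tsum_eq_tsum_sum_antidiagonal hv.of_norm
    (summable_mul_of_summable_norm hu hv)

theorem eval_mul [Fintype σ] [CompleteSpace K] (f g : Conv σ K) :
    eval (f * g) =ᶠ[nhds 0] eval f * eval g := by
  classical
  filter_upwards [eventually_summable f, eventually_summable g] with x hf hg
  rw [Pi.mul_apply, eval, eval, eval, tsum_mul_eq_tsum_antidiagonal hf hg]
  exact tsum_congr fun α => coeff_mul_mul_monom _ _ x α

theorem eval_monomial (α : σ →₀ ℕ) (c : K) (x : σ → K) :
    eval ⟨monomial α c, isConvergent_monomial α c⟩ x = c * monom x α := by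
  classical
  rw [eval, tsum_eq_single α]
  · change coeff α (monomial α c) * _ = _
    rw [coeff_monomial_same]
  · intro β hβ
    change coeff β (monomial α c) * _ = _
    rw [coeff_monomial_ne hβ, zero_mul]

theorem eval_algebraMap (c : K) (x : σ → K) : eval (algebraMap K (Conv σ K) c) x = c := by
  have := eval_monomial 0 c x
  rwa [monom_zero, mul_one] at this

theorem eval_X (i : σ) (x : σ → K) : eval (X i) x = x i := by
  have := eval_monomial (Finsupp.single i 1) 1 x
  rwa [monom_single, one_mul] at this

theorem eval_zero (f : Conv σ K) : eval f 0 = valZero f := by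
  rw [eval, tsum_eq_single 0]
  · rw [monom_zero, mul_one, coeff_zero_eq_constantCoeff_apply]
    rfl
  · intro α hα
    obtain ⟨i, hi⟩ := Finsupp.ne_iff.mp hα
    rw [monom, Finsupp.prod, Finset.prod_eq_zero (i := i), mul_zero]
    · simpa using hi
    · simpa using hi

theorem _root_.HasSum.of_eq {β M : Type*} [AddCommMonoid M] [TopologicalSpace M] {u v : β → M}
    {a : M} (h : HasSum u a) (huv : ∀ b, u b = v b) : HasSum v a :=
  (funext huv : u = v) ▸ h

/-- Summing over words amounts to summing over multi-indices. -/
theorem hasSum_words_iff {M : Type*} [AddCommMonoid M] [TopologicalSpace M]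
    {u : (σ →₀ ℕ) → M} {a : M} :
    HasSum (fun w : Σ m : ℕ, Fin m → σ => open Classical in
      if Function.surjInv content_surjective (content w) = w then u (content w) else 0) a ↔
    HasSum u a := by
  classical
  -- `surjInv` selects one word for each multi-index; all other words carry the weight zero.
  have hinj := Function.injective_surjInv (content_surjective (σ := σ))
  rw [← hinj.hasSum_iff]
  · refine iff_of_eq (congrArg (HasSum · a) (funext fun α => ?_))
    simp [Function.surjInv_eq content_surjective]
  · intro w hw
    rw [if_neg]
    exact fun h => hw ⟨_, h⟩

variable [Fintype σ]

/-- The homogeneous parts of a convergent power series, as multilinear maps. -/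
def multilinearSeries (f : Conv σ K) : FormalMultilinearSeries K (σ → K) K := fun m =>
  ∑ s : Fin m → σ, (open Classical in
    if Function.surjInv content_surjective (content ⟨m, s⟩) = ⟨m, s⟩ then
      coeff (content ⟨m, s⟩) (f : MvPowerSeries σ K) else 0) • wordForm K s

/-- The selected word of a multi-index carries its whole coefficient. The multilinear maps need not
be symmetric; only their values on the diagonal matter. -/
theorem multilinearSeries_apply (f : Conv σ K) (m : ℕ) (x : σ → K) :
    multilinearSeries f m (fun _ => x) = ∑ s : Fin m → σ, (open Classical in
    if Function.surjInv content_surjective (content ⟨m, s⟩) = ⟨m, s⟩ then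
      coeff (content ⟨m, s⟩) (f : MvPowerSeries σ K) else 0) * monom x (content ⟨m, s⟩) := by
  simp only [multilinearSeries, sum_apply, smul_apply, wordForm_apply, monom_content, smul_eq_mul]

variable [CompleteSpace K]

/-- Word forms have norm at most 1, so the norm of the m-th multilinear map is bounded by the sum of
the |c_α| with |α| = m, and absolute convergence at radius r passes to the multilinear series. -/
theorem hasFPowerSeriesAt_eval (f : Conv σ K) :
    HasFPowerSeriesAt (eval f) (multilinearSeries f) 0 := by
  classical
  obtain ⟨r, hr, hs⟩ := exists_radius f.2
  have hW := (hasSum_words_iff.mpr hs.hasSum).summable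
  have hnn : ∀ w : Σ m : ℕ, Fin m → σ, 0 ≤ (if Function.surjInv content_surjective (content w) = w
      then ‖coeff (content w) (f : MvPowerSeries σ K)‖ * r ^ (content w).degree else 0) := by
    intro w
    split_ifs <;> positivity
  have hsm := ((summable_sigma_of_nonneg hnn).mp hW).2
  lift r to NNReal using hr.le
  refine ⟨r, ?_, by exact_mod_cast hr, ?_⟩
  · refine FormalMultilinearSeries.le_radius_of_summable _
      (Summable.of_nonneg_of_le (fun m => by positivity) (fun m => ?_) hsm)
    rw [tsum_fintype, multilinearSeries]
    refine (mul_le_mul_of_nonneg_right (norm_sum_le _ _) (by positivity)).trans ?_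
    rw [Finset.sum_mul]
    refine Finset.sum_le_sum fun s _ => ?_
    rw [norm_smul, degree_content]
    split_ifs
    · refine mul_le_mul_of_nonneg_right ?_ (by positivity)
      exact mul_le_of_le_one_right (norm_nonneg _) (norm_wordForm_le K s)
    · simp
  · intro x hx
    rw [zero_add]
    have hx' : ‖x‖ ≤ r := by
      rw [Metric.mem_eball, edist_zero_right] at hx
      have := hx.le
      rw [enorm_eq_nnnorm] at this
      exact_mod_cast this
    have hsx : Summable fun α : σ →₀ ℕ => coeff α (f : MvPowerSeries σ K) * monom x α := by
      refine Summable.of_norm_bounded hs fun α => ?_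
      rw [norm_mul]
      exact mul_le_mul_of_nonneg_left (norm_monom_le hx' α) (norm_nonneg _)
    have h1 := hasSum_words_iff.mpr hsx.hasSum
    refine (h1.sigma fun m => hasSum_fintype _).of_eq fun m => ?_
    rw [multilinearSeries_apply]
    refine Finset.sum_congr rfl fun s _ => ?_
    rw [ite_mul, zero_mul]

theorem analyticAt_eval (f : Conv σ K) : AnalyticAt K (eval f) 0 :=
  (hasFPowerSeriesAt_eval f).analyticAt

/-- Each homogeneous part of a vanishing germ vanishes on the diagonal; it is a polynomial function
over an infinite field, so its coefficients are zero. -/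
theorem eq_zero_of_eval_eventuallyEq {f : Conv σ K} (h : eval f =ᶠ[nhds 0] 0) : f = 0 := by
  classical
  have hp : HasFPowerSeriesAt 0 (multilinearSeries f) (0 : σ → K) :=
    (hasFPowerSeriesAt_eval f).congr h
  refine ext_coeff fun α => ?_
  set d : (Fin α.degree → σ) → K := fun s =>
    if Function.surjInv content_surjective (content ⟨_, s⟩) = ⟨_, s⟩ then
      coeff (content ⟨_, s⟩) (f : MvPowerSeries σ K) else 0 with hd
  have hP : ∑ s : Fin α.degree → σ, MvPolynomial.monomial (content ⟨_, s⟩) (d s) = 0 := by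
    refine MvPolynomial.funext fun x => ?_
    rw [map_sum, map_zero, ← hp.apply_eq_zero α.degree x, multilinearSeries_apply]
    refine Finset.sum_congr rfl fun s _ => ?_
    rw [MvPolynomial.eval_monomial, monom]
  have hc := congrArg (MvPolynomial.coeff α) hP
  rw [MvPolynomial.coeff_sum, MvPolynomial.coeff_zero] at hc
  change coeff α (f : MvPowerSeries σ K) = 0
  rw [← hc]
  -- The word selected for α has length |α|, so it occurs in the sum, and it alone contributes to
  -- the coefficient of α.
  obtain ⟨s, hs⟩ : ∃ s : Fin α.degree → σ, Function.surjInv content_surjective α = ⟨_, s⟩ := by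
    have h1 := degree_content (Function.surjInv content_surjective α)
    rw [Function.surjInv_eq content_surjective] at h1
    generalize Function.surjInv content_surjective α = w at h1
    obtain ⟨m, s⟩ := w
    subst h1
    exact ⟨s, rfl⟩
  have hcs : content ⟨_, s⟩ = α := by rw [← hs, Function.surjInv_eq content_surjective]
  rw [Finset.sum_eq_single s]
  · rw [MvPolynomial.coeff_monomial, if_pos hcs, hd]
    simp only [hcs, hs, if_true]
  · intro t _ hts
    rw [MvPolynomial.coeff_monomial]
    split_ifs with ht
    · rw [hd]
      simp only [ht, hs]
      rw [if_neg]
      intro h'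
      simp only [Sigma.mk.injEq, heq_eq_eq, true_and] at h'
      exact hts h'.symm
    · rfl
  · simp

theorem eq_of_eval_eventuallyEq {f g : Conv σ K} (h : eval f =ᶠ[nhds 0] eval g) : f = g := by
  rw [← sub_eq_zero]
  refine eq_zero_of_eval_eventuallyEq ?_
  have h1 := eval_add (f - g) g
  rw [sub_add_cancel] at h1
  filter_upwards [h, h1] with x hx hx1
  rw [Pi.add_apply, hx] at hx1
  simpa using hx1

/-- Expanding p_m(x,…,x) in the standard basis gives a sum over words; collecting the words with the
same content gives the coefficients of f. Absolute convergence on a smaller polydisc justifies the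
regrouping. -/
theorem exists_eval_eq_of_analyticAt {F : (σ → K) → K} (hF : AnalyticAt K F 0) :
    ∃ f : Conv σ K, eval f =ᶠ[nhds 0] F := by
  classical
  obtain ⟨p, R, hp⟩ := hF
  obtain ⟨r, hr, hrR⟩ : ∃ r : NNReal, 0 < r ∧ (r : ENNReal) < R := by
    obtain ⟨r, h1, h2⟩ := ENNReal.lt_iff_exists_nnreal_btwn.mp hp.r_pos
    exact ⟨r, by exact_mod_cast h1, h2⟩
  set c : (Σ m : ℕ, Fin m → σ) → K := fun w => p w.1 fun j => Pi.single (w.2 j) 1 with hc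
  -- There are (card σ)^m words of length m, so the radius must shrink by at least card σ; the extra
  -- 1 keeps the divisor positive when there are no variables.
  set N : NNReal := Fintype.card σ + 1 with hN
  have hN0 : 0 < N := by positivity
  set ρ : NNReal := r / N with hρ
  have hρ0 : 0 < ρ := div_pos hr hN0
  have hρN : (Fintype.card σ : ℝ) * ρ ≤ r := by
    have : Fintype.card σ * ρ ≤ r := by
      rw [hρ, mul_div_assoc', div_le_iff₀ hN0, mul_comm]
      gcongr
      rw [hN]
      exact le_self_add
    exact_mod_cast this
  have hcle : ∀ w, ‖c w‖ ≤ ‖p w.1‖ := by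
    intro w
    refine ((p w.1).le_opNorm _).trans ?_
    have : ∏ j, ‖(Pi.single (w.2 j) 1 : σ → K)‖ = 1 :=
      Finset.prod_eq_one fun j _ => by
        rw [Pi.norm_single, norm_one]
    rw [this, mul_one]
  have hsum : Summable fun w : Σ m : ℕ, Fin m → σ => ‖c w‖ * ρ ^ w.1 := by
    rw [summable_sigma_of_nonneg fun w => by positivity]
    refine ⟨fun m => (hasSum_fintype _).summable, ?_⟩
    refine Summable.of_nonneg_of_le (fun m => tsum_nonneg fun _ => by positivity) (fun m => ?_)
      (p.summable_norm_mul_pow (hrR.trans_le hp.r_le))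
    rw [tsum_fintype]
    calc ∑ s : Fin m → σ, ‖c ⟨m, s⟩‖ * (ρ : ℝ) ^ m ≤ ∑ s : Fin m → σ, ‖p m‖ * (ρ : ℝ) ^ m :=
          Finset.sum_le_sum fun s _ =>
            mul_le_mul_of_nonneg_right (hcle ⟨m, s⟩) (by positivity)
      _ = ‖p m‖ * ((Fintype.card σ : ℝ) * ρ) ^ m := by
          rw [Finset.sum_const, Finset.card_univ, Fintype.card_fun, Fintype.card_fin, nsmul_eq_mul,
            mul_pow]
          push_cast
          ring
      _ ≤ ‖p m‖ * (r : ℝ) ^ m := by gcongr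
  have hfib : Summable fun w : Σ α : σ →₀ ℕ, {w : Σ m : ℕ, Fin m → σ // content w = α} =>
      ‖c w.2.1‖ * ρ ^ w.2.1.1 :=
    ((Equiv.sigmaFiberEquiv content).summable_iff (f := fun w => ‖c w‖ * (ρ : ℝ) ^ w.1)).mpr hsum
  have hfib' := (summable_sigma_of_nonneg fun w => by positivity).mp hfib
  have hdeg : ∀ (α : σ →₀ ℕ) (w : {w : Σ m : ℕ, Fin m → σ // content w = α}),
      w.1.1 = α.degree := fun α w => by rw [← degree_content, w.2]
  have hcs : ∀ α : σ →₀ ℕ, Summable fun w : {w : Σ m : ℕ, Fin m → σ // content w = α} =>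
      ‖c w.1‖ := by
    intro α
    have h1 := hfib'.1 α
    simp only [hdeg] at h1
    refine (h1.mul_right ((ρ : ℝ) ^ α.degree)⁻¹).congr fun w => ?_
    rw [mul_assoc, mul_inv_cancel₀ (by positivity), mul_one]
  let f : MvPowerSeries σ K :=
    fun α => ∑' w : {w : Σ m : ℕ, Fin m → σ // content w = α}, c w.1
  have hf : IsConvergent f := by
    refine ⟨fun _ => ρ, fun _ => by exact_mod_cast hρ0, ?_⟩
    refine Summable.of_nonneg_of_le (norm_term_nonneg f fun _ => by exact_mod_cast hρ0)
      (fun α => ?_) hfib'.2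
    change _ * monom (fun _ => (ρ : ℝ)) α ≤ _
    rw [monom_const]
    simp only [hdeg]
    rw [tsum_mul_right]
    exact mul_le_mul_of_nonneg_right (norm_tsum_le_tsum_norm (hcs α)) (by positivity)
  refine ⟨⟨f, hf⟩, ?_⟩
  have hρ0' : (0 : ℝ) < ρ := by exact_mod_cast hρ0
  filter_upwards [Metric.closedBall_mem_nhds (0 : σ → K) hρ0',
    Metric.eball_mem_nhds (0 : σ → K) hp.r_pos] with x hx hxR
  rw [mem_closedBall_zero_iff] at hx
  have hF := hp.hasSum hxR
  rw [zero_add] at hF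
  have hW : Summable fun w : Σ m : ℕ, Fin m → σ => c w * monom x (content w) := by
    refine Summable.of_norm_bounded hsum fun w => ?_
    rw [norm_mul]
    refine mul_le_mul_of_nonneg_left ((norm_monom_le hx _).trans ?_) (norm_nonneg _)
    rw [degree_content]
  have h1 : HasSum (fun m => p m fun _ => x) (∑' w, c w * monom x (content w)) := by
    refine (hW.hasSum.sigma fun m => hasSum_fintype _).of_eq fun m => Eq.symm ?_
    have hx' : x = ∑ i, x i • (Pi.single i 1 : σ → K) := by
      ext j
      simp [Pi.single_apply]
    conv_lhs => rw [hx']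
    rw [ContinuousMultilinearMap.map_sum]
    refine Finset.sum_congr rfl fun s _ => ?_
    rw [ContinuousMultilinearMap.map_smul_univ, monom_content, smul_eq_mul, mul_comm]
  have h2 : HasSum (fun α => f α * monom x α) (∑' w, c w * monom x (content w)) := by
    have h3 := ((Equiv.sigmaFiberEquiv content).hasSum_iff
      (f := fun w => c w * monom x (content w))).mpr hW.hasSum
    refine h3.sigma fun α => ?_
    have h4 := ((hcs α).of_norm.hasSum).mul_right (monom x α)
    refine h4.of_eq fun w => ?_
    change _ = c w.1 * monom x (content w.1)
    rw [w.2]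
  rw [hF.unique h1]
  exact h2.tsum_eq

end Germs

/-! ### Substitution, locality of homomorphisms and the chain rule. -/

section Algebra

variable {K : Type*} [NontriviallyNormedField K] {σ τ : Type*}

theorem eq_zero_of_forall_mem_pow {f : Conv σ K} (h : ∀ N, f ∈ maxIdeal σ K ^ N) : f = 0 :=
  ext_coeff fun α => coeff_eq_zero_of_mem_pow (α.degree + 1) f (h _) α (Nat.lt_succ_self _)

/-- The map of coordinate spaces given by a tuple of convergent power series. -/
def evalTuple (P : σ → Conv τ K) (x : τ → K) : σ → K := fun i => eval (P i) x

theorem evalTuple_zero {P : σ → Conv τ K} (hP : ∀ i, valZero (P i) = 0) :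
    evalTuple P 0 = 0 :=
  funext fun i => (eval_zero (P i)).trans (hP i)

theorem lin_algebraMap_add_sum [Fintype σ] (c : K) (q : σ → Conv σ K) (j : σ) :
    lin j (algebraMap K _ c + ∑ i, X i * q i) = valZero (q j) := by
  classical
  simp [lin_mul]

end Algebra

section Substitution

variable {K : Type*} [NontriviallyNormedField K] [CompleteSpace K] {σ τ : Type*} [Fintype σ]
  [Fintype τ]

theorem analyticAt_evalTuple (P : σ → Conv τ K) : AnalyticAt K (evalTuple P) 0 :=
  AnalyticAt.pi fun i => analyticAt_eval (P i)

theorem tendsto_evalTuple {P : σ → Conv τ K} (hP : ∀ i, valZero (P i) = 0) :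
    Filter.Tendsto (evalTuple P) (nhds 0) (nhds 0) := by
  have := (analyticAt_evalTuple P).continuousAt.tendsto
  rwa [evalTuple_zero hP] at this

theorem exists_eval_eq_comp {P : σ → Conv τ K} (hP : ∀ i, valZero (P i) = 0) (f : Conv σ K) :
    ∃ g : Conv τ K, eval g =ᶠ[nhds 0] eval f ∘ evalTuple P := by
  refine exists_eval_eq_of_analyticAt (AnalyticAt.comp ?_ (analyticAt_evalTuple P))
  rw [evalTuple_zero hP]
  exact analyticAt_eval f

/-- The series `f(P)`. -/
def substFun {P : σ → Conv τ K} (hP : ∀ i, valZero (P i) = 0) (f : Conv σ K) : Conv τ K :=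
  (exists_eval_eq_comp hP f).choose

theorem eval_substFun {P : σ → Conv τ K} (hP : ∀ i, valZero (P i) = 0) (f : Conv σ K) :
    eval (substFun hP f) =ᶠ[nhds 0] eval f ∘ evalTuple P :=
  (exists_eval_eq_comp hP f).choose_spec

theorem substFun_algebraMap {P : σ → Conv τ K} (hP : ∀ i, valZero (P i) = 0) (c : K) :
    substFun hP (algebraMap K _ c) = algebraMap K _ c := by
  refine eq_of_eval_eventuallyEq ((eval_substFun hP _).trans (Filter.Eventually.of_forall ?_))
  intro x
  rw [Function.comp_apply, eval_algebraMap, eval_algebraMap]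

/-- Substitution of convergent power series without constant term. -/
def subst (P : σ → Conv τ K) (hP : ∀ i, valZero (P i) = 0) : Conv σ K →ₐ[K] Conv τ K where
  toFun := substFun hP
  map_one' := by
    have := substFun_algebraMap hP 1
    rwa [map_one, map_one] at this
  map_zero' := by
    have := substFun_algebraMap hP 0
    rwa [map_zero, map_zero] at this
  map_mul' f g := by
    refine eq_of_eval_eventuallyEq ?_
    filter_upwards [eval_substFun hP (f * g), eval_mul (substFun hP f) (substFun hP g),
      eval_substFun hP f, eval_substFun hP g, (tendsto_evalTuple hP).eventually (eval_mul f g)]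
      with x h1 h2 h3 h4 h5
    rw [h1, h2, Pi.mul_apply, h3, h4, Function.comp_apply, h5]
    rfl
  map_add' f g := by
    refine eq_of_eval_eventuallyEq ?_
    filter_upwards [eval_substFun hP (f + g), eval_add (substFun hP f) (substFun hP g),
      eval_substFun hP f, eval_substFun hP g, (tendsto_evalTuple hP).eventually (eval_add f g)]
      with x h1 h2 h3 h4 h5
    rw [h1, h2, Pi.add_apply, h3, h4, Function.comp_apply, h5]
    rfl
  commutes' := substFun_algebraMap hP

theorem eval_subst {P : σ → Conv τ K} (hP : ∀ i, valZero (P i) = 0) (f : Conv σ K) :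
    eval (subst P hP f) =ᶠ[nhds 0] eval f ∘ evalTuple P := eval_substFun hP f

@[simp] theorem subst_X (P : σ → Conv τ K) (hP : ∀ i, valZero (P i) = 0) (i : σ) :
    subst P hP (X i) = P i := by
  refine eq_of_eval_eventuallyEq ((eval_subst hP _).trans (Filter.Eventually.of_forall ?_))
  intro x
  rw [Function.comp_apply, eval_X]
  rfl

/-- The reciprocal of the germ is analytic, hence the sum of a convergent series. -/
theorem isUnit_of_valZero_ne_zero {f : Conv σ K} (hf : valZero f ≠ 0) : IsUnit f := by
  have h0 : eval f 0 ≠ 0 := by rwa [eval_zero]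
  obtain ⟨g, hg⟩ := exists_eval_eq_of_analyticAt ((analyticAt_eval f).inv h0)
  refine IsUnit.of_mul_eq_one g ?_
  refine eq_of_eval_eventuallyEq ?_
  filter_upwards [eval_mul f g, hg, (analyticAt_eval f).continuousAt.eventually_ne h0]
    with x h1 h2 h3
  rw [h1, Pi.mul_apply, h2, ← map_one (algebraMap K (Conv σ K)), eval_algebraMap, Pi.inv_apply,
    mul_inv_cancel₀ h3]

theorem isUnit_iff {f : Conv σ K} : IsUnit f ↔ valZero f ≠ 0 :=
  ⟨fun h => (h.map (valZero : Conv σ K →ₐ[K] K)).ne_zero, isUnit_of_valZero_ne_zero⟩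

/-- Every algebra homomorphism is local. -/
@[simp] theorem valZero_map (φ : Conv σ K →ₐ[K] Conv τ K) (f : Conv σ K) :
    valZero (φ f) = valZero f := by
  by_contra h
  -- If the values differed, this would be a unit, while its image under φ vanishes at the origin.
  have h1 : IsUnit (f - algebraMap K _ (valZero (φ f))) := by
    refine isUnit_of_valZero_ne_zero ?_
    rw [map_sub, AlgHom.commutes, Algebra.algebraMap_self_apply]
    exact sub_ne_zero.mpr (Ne.symm h)
  have h2 := isUnit_iff.mp (h1.map φ)
  rw [map_sub, map_sub, AlgHom.commutes, AlgHom.commutes, Algebra.algebraMap_self_apply,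
    sub_self] at h2
  exact h2 rfl

theorem map_mem_maxIdeal (φ : Conv σ K →ₐ[K] Conv τ K) {f : Conv σ K} (hf : f ∈ maxIdeal σ K) :
    φ f ∈ maxIdeal τ K := by
  rw [mem_maxIdeal_iff] at hf ⊢
  rwa [valZero_map]

theorem map_mem_maxIdeal_pow (φ : Conv σ K →ₐ[K] Conv τ K) {N : ℕ} {f : Conv σ K}
    (hf : f ∈ maxIdeal σ K ^ N) : φ f ∈ maxIdeal τ K ^ N := by
  have h1 : Ideal.map φ (maxIdeal σ K ^ N) ≤ maxIdeal τ K ^ N := by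
    rw [Ideal.map_pow]
    refine Ideal.pow_right_mono (Ideal.map_le_iff_le_comap.mpr fun g hg => ?_) N
    exact map_mem_maxIdeal φ hg
  exact h1 (Ideal.mem_map_of_mem φ hf)

/-- An algebra homomorphism is determined by the images of the variables. -/
theorem algHom_ext {φ ψ : Conv σ K →ₐ[K] Conv τ K} (h : ∀ i, φ (X i) = ψ (X i)) : φ = ψ := by
  -- Each division by the variables, whose images agree and lie in 𝔪, gains one order of vanishing;
  -- the powers of 𝔪 intersect in zero.
  have key : ∀ N, ∀ f, φ f - ψ f ∈ maxIdeal τ K ^ N := by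
    intro N
    induction N with
    | zero => simp
    | succ N ih =>
      intro f
      obtain ⟨q, hq, -⟩ := exists_eq_sum_X_mul f
      have : φ f - ψ f = ∑ i, φ (X i) * (φ (q i) - ψ (q i)) := by
        conv_lhs => rw [hq]
        simp only [map_add, map_sum, map_mul, AlgHom.commutes, h, mul_sub, Finset.sum_sub_distrib]
        ring
      rw [this, pow_succ']
      refine Ideal.sum_mem _ fun i _ => Ideal.mul_mem_mul (map_mem_maxIdeal φ ?_) (ih _)
      exact Ideal.subset_span ⟨i, rfl⟩
  exact AlgHom.ext fun f => sub_eq_zero.mp (eq_zero_of_forall_mem_pow fun N => key N f)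

/-- The derivative at the origin in the direction `v`. -/
def dirDeriv (v : σ → K) : Conv σ K →+ K :=
  AddMonoidHom.mk' (fun f => fderiv K (eval f) 0 v) fun f g => by
    rw [(eval_add f g).fderiv_eq, fderiv_add (analyticAt_eval f).differentiableAt
      (analyticAt_eval g).differentiableAt]
    rfl

theorem dirDeriv_mul (v : σ → K) (f g : Conv σ K) :
    dirDeriv v (f * g) = valZero f * dirDeriv v g + valZero g * dirDeriv v f := by
  change fderiv K (eval (f * g)) 0 v = _ * fderiv K (eval g) 0 v + _ * fderiv K (eval f) 0 v
  rw [(eval_mul f g).fderiv_eq, fderiv_mul (analyticAt_eval f).differentiableAt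
      (analyticAt_eval g).differentiableAt, eval_zero, eval_zero]
  rfl

theorem dirDeriv_X (v : σ → K) (i : σ) : dirDeriv v (X i) = v i := by
  change fderiv K (eval (X i)) 0 v = _
  have : (eval (X i) : (σ → K) → K) = ContinuousLinearMap.proj (R := K) (φ := fun _ => K) i :=
    funext fun x => eval_X i x
  rw [this, ContinuousLinearMap.fderiv]
  rfl

theorem dirDeriv_algebraMap (v : σ → K) (c : K) : dirDeriv v (algebraMap K _ c) = 0 := by
  change fderiv K (eval (algebraMap K _ c)) 0 v = _
  have : (eval (algebraMap K _ c) : (σ → K) → K) = fun _ => c :=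
    funext fun x => eval_algebraMap c x
  rw [this]
  simp

/-- Links the Fréchet derivative with the formal linear coefficients: both obey the Leibniz rule at
0, so division with remainder reduces the claim to constants and variables. -/
theorem dirDeriv_eq_sum_lin (v : σ → K) (f : Conv σ K) :
    dirDeriv v f = ∑ j, lin j f * v j := by
  obtain ⟨q, hq, -⟩ := exists_eq_sum_X_mul f
  rw [hq]
  simp only [lin_algebraMap_add_sum]
  simp [dirDeriv_mul, dirDeriv_X, dirDeriv_algebraMap]

/-- The chain rule for linear parts. -/
theorem lin_map (φ : Conv σ K →ₐ[K] Conv τ K) (f : Conv σ K) (j : τ) :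
    lin j (φ f) = ∑ i, lin i f * lin j (φ (X i)) := by
  obtain ⟨q, hq, -⟩ := exists_eq_sum_X_mul f
  rw [hq]
  simp only [lin_algebraMap_add_sum]
  simp [lin_mul]

end Substitution

/-! ### The inverse function theorem for convergent series. -/

section Inverse

variable {K : Type*} [RCLike K] {σ τ ι : Type*} [Fintype σ] [DecidableEq σ]

/-- The Jacobian matrix at the origin. -/
def jacobian (P : σ → Conv σ K) : Matrix σ σ K := Matrix.of fun i j => lin j (P i)

theorem hasFDerivAt_evalTuple (P : σ → Conv σ K) :
    HasFDerivAt (evalTuple P) (Matrix.toLin' (jacobian P)).toContinuousLinearMap 0 := by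
  have h := (analyticAt_evalTuple P).differentiableAt.hasFDerivAt
  have hL : fderiv K (evalTuple P) 0 = (Matrix.toLin' (jacobian P)).toContinuousLinearMap := by
    refine ContinuousLinearMap.ext fun v => funext fun i => ?_
    have h2 : HasFDerivAt (eval (P i)) ((ContinuousLinearMap.proj i).comp
      (fderiv K (evalTuple P) 0)) 0 := (hasFDerivAt_pi'.mp h) i
    change ((ContinuousLinearMap.proj (R := K) (φ := fun _ => K) i).comp
      (fderiv K (evalTuple P) 0)) v = _
    rw [← h2.fderiv]
    exact dirDeriv_eq_sum_lin v (P i)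
  rwa [hL] at h

/-- The inverse function theorem: a substitution with invertible Jacobian is an automorphism. -/
theorem exists_algEquiv_of_isUnit_det (φ : Conv σ K →ₐ[K] Conv σ K)
    (hφ : IsUnit (jacobian fun i => φ (X i)).det) :
    ∃ ψ : Conv σ K ≃ₐ[K] Conv σ K, ∀ f, ψ f = φ f := by
  set P : σ → Conv σ K := fun i => φ (X i) with hPdef
  have hP : ∀ i, valZero (P i) = 0 := fun i => by simp only [hPdef, valZero_map, valZero_X]
  have hφP : φ = subst P hP := algHom_ext fun i => by rw [subst_X]
  let L : (σ → K) ≃L[K] (σ → K) := (Matrix.toLinearEquiv' (jacobian P)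
    (Matrix.invertibleOfIsUnitDet _ hφ)).toContinuousLinearEquiv
  have hL : HasFDerivAt (evalTuple P) (L : (σ → K) →L[K] (σ → K)) 0 := hasFDerivAt_evalTuple P
  have hC : ContDiffAt K ⊤ (evalTuple P) 0 := (analyticAt_evalTuple P).contDiffAt
  have hS := hC.hasStrictFDerivAt' hL (by simp)
  have hΨ : AnalyticAt K (hS.localInverse (evalTuple P) L 0) 0 := by
    have h := (hC.to_localInverse hL (by simp)).analyticAt
    rw [evalTuple_zero hP] at h
    exact h
  have hΨ0 : hS.localInverse (evalTuple P) L 0 0 = 0 := by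
    have h := hS.localInverse_apply_image
    rwa [evalTuple_zero hP] at h
  have hl := hS.eventually_left_inverse
  have hr := hS.eventually_right_inverse
  rw [evalTuple_zero hP] at hr
  -- The components of the analytic local inverse are sums of convergent series Q_i, and
  -- substituting Q inverts φ.
  choose Q hQ using fun i => exists_eval_eq_of_analyticAt ((analyticAt_pi_iff.mp hΨ) i)
  have hQ0 : ∀ i, valZero (Q i) = 0 := fun i => by
    rw [← eval_zero, (hQ i).eq_of_nhds, hΨ0]
    rfl
  have hQe : evalTuple Q =ᶠ[nhds 0] hS.localInverse (evalTuple P) L 0 := by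
    filter_upwards [Filter.eventually_all.mpr hQ] with x hx
    exact funext hx
  refine ⟨AlgEquiv.ofAlgHom φ (subst Q hQ0) (algHom_ext fun i => ?_) (algHom_ext fun i => ?_),
    fun f => rfl⟩
  · rw [AlgHom.comp_apply, subst_X, AlgHom.id_apply, hφP]
    refine eq_of_eval_eventuallyEq ?_
    filter_upwards [eval_subst hP (Q i), hl, (tendsto_evalTuple hP).eventually (hQ i)]
      with x h1 h2 h3
    rw [h1, Function.comp_apply, h3, h2, eval_X]
  · rw [AlgHom.comp_apply, AlgHom.id_apply]
    change subst Q hQ0 (P i) = _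
    refine eq_of_eval_eventuallyEq ?_
    filter_upwards [eval_subst hQ0 (P i), hr, hQe] with x h1 h2 h3
    rw [h1, Function.comp_apply, h3, eval_X]
    exact congrFun h2 i

/-- The Jacobian of an automorphism is invertible. -/
theorem isUnit_det_jacobian (φ : Conv σ K ≃ₐ[K] Conv σ K) :
    IsUnit (jacobian fun i => φ (X i)).det := by
  have h : (jacobian fun i => φ.symm (X i)) * (jacobian fun i => φ (X i)) = 1 := by
    ext i j
    have : lin j (φ (φ.symm (X i))) = ∑ k, lin k (φ.symm (X i)) * lin j (φ (X k)) :=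
      lin_map φ.toAlgHom (φ.symm (X i)) j
    rw [AlgEquiv.apply_symm_apply, lin_X] at this
    refine Matrix.mul_apply.trans (Eq.trans ?_ Matrix.one_apply.symm)
    exact this.symm.trans (if_congr eq_comm rfl rfl)
  exact Matrix.isUnit_det_of_left_inverse h

/-- A substitution that is the identity up to terms of order two is an automorphism. -/
theorem exists_algEquiv_of_sub_mem (φ : Conv σ K →ₐ[K] Conv σ K)
    (hφ : ∀ i, φ (X i) - X i ∈ maxIdeal σ K ^ 2) :
    ∃ ψ : Conv σ K ≃ₐ[K] Conv σ K, ∀ f, ψ f = φ f := by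
  refine exists_algEquiv_of_isUnit_det φ ?_
  have : (jacobian fun i => φ (X i)) = 1 := by
    ext i j
    have h := lin_eq_zero_of_mem (hφ i) j
    rw [map_sub, sub_eq_zero, lin_X] at h
    rw [Matrix.one_apply]
    exact h.trans (if_congr eq_comm rfl rfl)
  rw [this, Matrix.det_one]
  exact isUnit_one

end Inverse

/-! ### Two groups of variables and the implicit function theorem. -/

section SumVariables

variable {K : Type*} [NormedField K] {ι τ : Type*}

/-- Convergent power series in the second group of variables only. -/
abbrev inclR : Conv τ K →ₐ[K] Conv (ι ⊕ τ) K := incl Function.Embedding.inr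

/-- Setting the first group of variables to zero. -/
abbrev resR : Conv (ι ⊕ τ) K →ₐ[K] Conv τ K := res Function.Embedding.inr

@[simp] theorem inclR_X (j : τ) : inclR (X j : Conv τ K) = X (Sum.inr j : ι ⊕ τ) := incl_X _ j

@[simp] theorem resR_X_inr (j : τ) : resR (X (Sum.inr j : ι ⊕ τ) : Conv _ K) = X j :=
  res_X Function.Embedding.inr j

@[simp] theorem resR_X_inl (i : ι) : resR (X (Sum.inl i : ι ⊕ τ) : Conv _ K) = (0 : Conv τ K) :=
  res_X_eq_zero _ (by simp)

theorem X_mem_maxIdeal {σ : Type*} (i : σ) : (X i : Conv σ K) ∈ maxIdeal σ K :=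
  Ideal.subset_span ⟨i, rfl⟩

/-- Division by the first group of variables. -/
theorem exists_relative_division [Fintype ι] [Fintype τ] (f : Conv (ι ⊕ τ) K) :
    ∃ q : ι → Conv (ι ⊕ τ) K, f = inclR (resR f) + ∑ i, X (Sum.inl i) * q i ∧
      ∀ N, f ∈ maxIdeal (ι ⊕ τ) K ^ (N + 1) → ∀ i, q i ∈ maxIdeal (ι ⊕ τ) K ^ N := by
  classical
  obtain ⟨q, hq, h0, h1⟩ := exists_division (Finset.univ.map Function.Embedding.inl) f
  refine ⟨fun i => q (Sum.inl i), ?_, fun N hN i => ?_⟩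
  · rw [← sub_eq_iff_eq_add]
    simp only [Finset.sum_map, Function.Embedding.inl_apply] at h0 h1
    refine ext_coeff fun α => ?_
    by_cases hα : ∀ i, α (Sum.inl i) = 0
    · obtain ⟨β, rfl⟩ : α ∈ Set.range (Finsupp.embDomain Function.Embedding.inr) := by
        rw [Finsupp.mem_range_embDomain_iff]
        rintro (i | j) hij
        · simp [hα] at hij
        · exact ⟨j, rfl⟩
      rw [h0 _ (by simp), coeff_incl, coeff_res]
    · push Not at hα
      rw [h1 α (by simpa using hα)]
      refine (coeff_rename_eq_zero _ _ ?_).symm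
      rintro ⟨β, rfl⟩
      obtain ⟨i, hi⟩ := hα
      refine hi (Finsupp.mapDomain_of_notMem_range _ _ ?_)
      simp
  · rw [mem_maxIdeal_pow_iff] at hN ⊢
    intro α hα
    rcases hq (Sum.inl i) α with h | h
    · exact h
    · rw [h]
      apply hN
      simpa [Finsupp.degree_single] using hα

end SumVariables

section Implicit

variable {K : Type*} [RCLike K] {ι τ : Type*} [Fintype ι] [Fintype τ]

theorem lin_inl_inclR [DecidableEq ι] [DecidableEq τ] (i : ι) (f : Conv τ K) :
    lin (Sum.inl i) (inclR f : Conv (ι ⊕ τ) K) = 0 := by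
  rw [lin_map]
  simp

theorem algHom_apply_eq {σ : Type*} [Fintype σ] {φ ψ : Conv σ K →ₐ[K] Conv τ K}
    (h : ∀ i, φ (X i) = ψ (X i)) (f : Conv σ K) : φ f = ψ f := by
  rw [algHom_ext h]

/-- The implicit function theorem. -/
theorem exists_implicit [DecidableEq ι] [DecidableEq τ] (P : ι → Conv (ι ⊕ τ) K)
    (h0 : ∀ i, valZero (P i) = 0)
    (h1 : ∀ i j, lin (Sum.inl j) (P i) = if i = j then 1 else 0) :
    ∃ ρ : Conv (ι ⊕ τ) K →ₐ[K] Conv τ K, (∀ w, ρ (inclR w) = w) ∧ ∀ i, ρ (P i) = 0 := by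
  -- The map (x,y) ↦ (P(x,y), y) has a block triangular Jacobian with identity diagonal blocks. In
  -- the inverse coordinates P becomes x, so setting x = 0 solves P = 0.
  let φ : Conv (ι ⊕ τ) K →ₐ[K] Conv (ι ⊕ τ) K :=
    subst (Sum.elim P fun j => X (Sum.inr j)) (by rintro (i | j) <;> simp [h0])
  have hφl : ∀ i, φ (X (Sum.inl i)) = P i := fun i => by simp [φ]
  have hφr : ∀ j, φ (X (Sum.inr j)) = X (Sum.inr j) := fun j => by simp [φ]
  have hJ : (jacobian fun z => φ (X z)) =
      Matrix.fromBlocks 1 (Matrix.of fun i j => lin (Sum.inr j) (P i)) 0 1 := by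
    refine Matrix.ext fun z w => ?_
    change lin w (φ (X z)) = _
    rcases z with i | j <;> rcases w with i' | j'
    · rw [hφl, h1, Matrix.fromBlocks_apply₁₁, Matrix.one_apply]
    · rw [hφl]
      rfl
    · rw [hφr, lin_X]
      simp
    · rw [hφr, lin_X, Matrix.fromBlocks_apply₂₂, Matrix.one_apply]
      simp [eq_comm]
  obtain ⟨ψ, hψ⟩ := exists_algEquiv_of_isUnit_det φ (by
    rw [hJ, Matrix.det_fromBlocks_zero₂₁]
    simp)
  refine ⟨resR.comp ψ.symm.toAlgHom, fun w => ?_, fun i => ?_⟩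
  · have h : ψ (inclR w) = inclR w := by
      rw [hψ]
      exact algHom_apply_eq (φ := φ.comp inclR) (ψ := inclR) (fun j => by simp [hφr]) w
    change resR (ψ.symm (inclR w)) = w
    rw [ψ.symm_apply_eq.mpr h.symm, res_incl]
  · change resR (ψ.symm (P i)) = 0
    rw [ψ.symm_apply_eq.mpr ((hφl i).symm.trans (hψ _).symm), resR_X_inl]

end Implicit

/-! ### The two algebraic identities behind completing the square. -/

section Identities

variable {K A ι : Type*} [Field K] [CommRing A] [Algebra K A] [Fintype ι]

/-- The cross terms 2a_i x_i u_i of the squares cancel against the linear terms −2a_i u_i x_i, which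
are what h contributes at the critical point. -/
theorem sum_sq_add_identity (a : ι → K) (x u : ι → A) (E : ι → ι → A) (r : A) :
    ∑ i, a i • (x i + u i) ^ 2 +
        (r + ∑ i, x i * (-((2 * a i) • u i) + ∑ j, x j * E i j)) =
      ∑ i, a i • x i ^ 2 + (∑ i, a i • u i ^ 2 + r) + ∑ i, ∑ j, x i * x j * E i j := by
  have h : ∀ i, a i • (x i + u i) ^ 2 + x i * (-((2 * a i) • u i) + ∑ j, x j * E i j) =
      a i • x i ^ 2 + a i • u i ^ 2 + ∑ j, x i * x j * E i j := by
    intro i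
    simp only [mul_assoc, ← Finset.mul_sum, Algebra.smul_def, map_mul, map_ofNat]
    ring
  have h2 := Finset.sum_congr (s₁ := Finset.univ) rfl fun i _ => h i
  simp only [Finset.sum_add_distrib] at h2
  linear_combination h2

/-- With D = diag(a) and B = 1 + (2D)⁻¹W, one has BᵀDB = D + (W + Wᵀ)/2 + Wᵀ(4D)⁻¹W; as quadratic
forms, W and (W + Wᵀ)/2 agree. -/
theorem sum_sq_complete_identity [CharZero K] {a : ι → K} (ha : ∀ i, a i ≠ 0) (x : ι → A)
    (W : ι → ι → A) :
    ∑ i, a i • (x i + (2 * a i)⁻¹ • ∑ j, W i j * x j) ^ 2 =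
      ∑ i, a i • x i ^ 2 +
        ∑ i, ∑ j, x i * x j * (W i j + ∑ c, (4 * a c)⁻¹ • (W c i * W c j)) := by
  have h1 : ∀ i, a i • (x i + (2 * a i)⁻¹ • ∑ j, W i j * x j) ^ 2 =
      a i • x i ^ 2 + ∑ j, x i * x j * W i j +
        (4 * a i)⁻¹ • ((∑ j, W i j * x j) * ∑ j, W i j * x j) := by
    intro i
    have e1 : ∑ j, x i * x j * W i j = x i * ∑ j, W i j * x j := by
      rw [Finset.mul_sum]
      exact Finset.sum_congr rfl fun j _ => by ring
    rw [e1]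
    generalize ∑ j, W i j * x j = S
    have e2 : algebraMap K A (a i) * algebraMap K A (2 * a i)⁻¹ * 2 = 1 := by
      rw [← map_ofNat (algebraMap K A) 2, ← map_mul, ← map_mul, ← map_one (algebraMap K A)]
      congr 1
      have := ha i
      field_simp
    have e3 : algebraMap K A (a i) * algebraMap K A (2 * a i)⁻¹ * algebraMap K A (2 * a i)⁻¹ =
        algebraMap K A (4 * a i)⁻¹ := by
      rw [← map_mul, ← map_mul]
      congr 1
      have := ha i
      field_simp
      norm_num
    simp only [Algebra.smul_def]
    linear_combination (x i * S) * e2 + S * S * e3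
  have h2 : ∑ i, ∑ j, x i * x j * ∑ c, (4 * a c)⁻¹ • (W c i * W c j) =
      ∑ c, (4 * a c)⁻¹ • ((∑ j, W c j * x j) * ∑ j, W c j * x j) := by
    simp only [Finset.sum_mul_sum]
    simp only [Finset.smul_sum, Finset.mul_sum]
    rw [Finset.sum_congr rfl fun i _ => Finset.sum_comm, Finset.sum_comm]
    refine Finset.sum_congr rfl fun c _ => Finset.sum_congr rfl fun i _ =>
      Finset.sum_congr rfl fun j _ => ?_
    simp only [Algebra.smul_def]
    ring
  simp only [mul_add, Finset.sum_add_distrib, h1, h2]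
  ring

end Identities

/-! ### Existence for a series with diagonal quadratic part. -/

section Existence

variable {K : Type*} [RCLike K] {ι τ : Type*} [Fintype ι] [Fintype τ]

/-- Taking the critical point in the first group of variables as new origin. -/
theorem exists_shift {a : ι → K} (ha : ∀ i, a i ≠ 0) {h : Conv (ι ⊕ τ) K}
    (hh : h ∈ maxIdeal (ι ⊕ τ) K ^ 3) :
    ∃ φ : Conv (ι ⊕ τ) K ≃ₐ[K] Conv (ι ⊕ τ) K, ∃ g ∈ maxIdeal τ K ^ 3,
      ∃ E : ι → ι → Conv (ι ⊕ τ) K, (∀ i j, valZero (E i j) = 0) ∧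
        φ (∑ i, a i • X (Sum.inl i) ^ 2 + h) = ∑ i, a i • X (Sum.inl i) ^ 2 + inclR g +
          ∑ i, ∑ j, X (Sum.inl i) * X (Sum.inl j) * E i j := by
  classical
  -- h(x,y) ↦ h(x+u,y), with the shift u as a new group of variables.
  let s : Conv (ι ⊕ τ) K →ₐ[K] Conv (ι ⊕ (ι ⊕ τ)) K :=
    subst (Sum.elim (fun i => X (Sum.inl i) + X (Sum.inr (Sum.inl i)))
      fun j => X (Sum.inr (Sum.inr j))) (by rintro (i | j) <;> simp)
  have hsl : ∀ i, s (X (Sum.inl i)) = X (Sum.inl i) + X (Sum.inr (Sum.inl i)) :=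
    fun i => by simp [s]
  have hsr : ∀ j, s (X (Sum.inr j)) = X (Sum.inr (Sum.inr j)) := fun j => by simp [s]
  obtain ⟨q, hq, hqord⟩ := exists_relative_division (s h)
  have hq2 := hqord 2 (map_mem_maxIdeal_pow s hh)
  have hres : resR (s h) = h := by
    refine algHom_apply_eq (φ := resR.comp s) (ψ := AlgHom.id K _) ?_ h
    rintro (i | j) <;> simp [hsl, hsr]
  rw [hres] at hq
  -- `resR (q i)` is ∂h/∂x_i at (u,y), so these are the critical point equations divided by 2a_i; as
  -- it has order two, their linear part in u is the identity.
  obtain ⟨ρ, hρ, hρP⟩ := exists_implicit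
    (fun i => X (Sum.inl i) + (2 * a i)⁻¹ • resR (q i)) (fun i => by
      rw [map_add, map_smul, valZero_X, valZero_map, valZero_eq_zero_of_mem
        (Ideal.pow_le_self two_ne_zero (hq2 i)), smul_zero, add_zero]) (fun i j => by
      rw [map_add, map_smul, lin_eq_zero_of_mem (map_mem_maxIdeal_pow _ (hq2 i)), smul_zero,
        add_zero, lin_X]
      simp [eq_comm])
  set v : ι → Conv τ K := fun i => ρ (X (Sum.inl i)) with hv
  have hρq : ∀ i, ρ (resR (q i)) = -((2 * a i) • v i) := by
    intro i
    have h1 := hρP i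
    rw [map_add, map_smul] at h1
    have h2 : (2 * a i) ≠ 0 := mul_ne_zero two_ne_zero (ha i)
    have h3 : (2 * a i) • (v i + (2 * a i)⁻¹ • ρ (resR (q i))) = 0 := by rw [hv, h1, smul_zero]
    rw [smul_add, smul_smul, mul_inv_cancel₀ h2, one_smul, add_comm] at h3
    exact eq_neg_of_add_eq_zero_left h3
  have hv2 : ∀ i, v i ∈ maxIdeal τ K ^ 2 := by
    intro i
    have h2 : (2 * a i) ≠ 0 := mul_ne_zero two_ne_zero (ha i)
    have h3 : v i = (-(2 * a i)⁻¹) • ρ (resR (q i)) := by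
      rw [hρq, smul_neg, neg_smul, neg_neg, smul_smul, inv_mul_cancel₀ h2, one_smul]
    rw [h3]
    exact Submodule.smul_of_tower_mem _ _
      (map_mem_maxIdeal_pow ρ (map_mem_maxIdeal_pow resR (hq2 i)))
  have hρr : ∀ j, ρ (X (Sum.inr j)) = X j := fun j => by rw [← inclR_X, hρ]
  -- Specialises u to the critical point v(y) and keeps x free, so that t ∘ s is x ↦ x + v(y).
  let t : Conv (ι ⊕ (ι ⊕ τ)) K →ₐ[K] Conv (ι ⊕ τ) K :=
    subst (Sum.elim (fun i => X (Sum.inl i)) fun z => inclR (ρ (X z)))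
      (by rintro (i | z) <;> simp)
  have htl : ∀ i, t (X (Sum.inl i)) = X (Sum.inl i) := fun i => by simp [t]
  have htr : ∀ z, t (X (Sum.inr z)) = inclR (ρ (X z)) := fun z => by simp [t]
  have htincl : ∀ w, t (inclR w) = inclR (ρ w) := fun w =>
    algHom_apply_eq (φ := t.comp inclR) (ψ := inclR.comp ρ) (fun z => by simp [htr]) w
  have hrest : ∀ w, resR (t w) = ρ (resR w) := fun w => by
    refine algHom_apply_eq (φ := resR.comp t) (ψ := ρ.comp resR) ?_ w
    rintro (i | z) <;> simp [htl, htr]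
  choose E hE hEord using fun i => exists_relative_division (t (q i))
  obtain ⟨φ, hφ⟩ := exists_algEquiv_of_sub_mem (t.comp s) (by
    rintro (i | j)
    · rw [AlgHom.comp_apply, hsl, map_add, htl, htr, add_sub_cancel_left]
      exact map_mem_maxIdeal_pow _ (hv2 i)
    · rw [AlgHom.comp_apply, hsr, htr, hρr, inclR_X, sub_self]
      exact Ideal.zero_mem _)
  -- The residual part is the critical value, i.e. the original series at x = v(y).
  refine ⟨φ, ∑ i, a i • v i ^ 2 + ρ h, ?_, E, fun i j => ?_, ?_⟩
  · refine Ideal.add_mem _ (Ideal.sum_mem _ fun i _ => Submodule.smul_of_tower_mem _ _ ?_)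
      (map_mem_maxIdeal_pow ρ hh)
    have := Ideal.pow_mem_pow (hv2 i) 2
    rw [← pow_mul] at this
    exact Ideal.pow_le_pow_right (by norm_num) this
  · refine valZero_eq_zero_of_mem ?_
    rw [← pow_one (maxIdeal (ι ⊕ τ) K)]
    exact hEord i 1 (map_mem_maxIdeal_pow t (hq2 i)) j
  · have hth : t (s h) = inclR (ρ h) + ∑ i, X (Sum.inl i) *
        (-((2 * a i) • inclR (v i)) + ∑ j, X (Sum.inl j) * E i j) := by
      conv_lhs => rw [hq]
      rw [map_add, htincl, map_sum]
      congr 1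
      refine Finset.sum_congr rfl fun i _ => ?_
      rw [map_mul, htl, hE i, hrest, hρq, map_neg, map_smul]
    rw [hφ, AlgHom.comp_apply, map_add, map_add, hth]
    simp only [map_sum, map_smul, map_pow, hsl, map_add, htl, htr]
    exact sum_sq_add_identity a _ _ E _

/-- Absorbing the terms of order at least three in the quadratic form. -/
theorem exists_complete_square {a : ι → K} (ha : ∀ i, a i ≠ 0) (g : Conv τ K)
    {E : ι → ι → Conv (ι ⊕ τ) K} (hE : ∀ i j, valZero (E i j) = 0) :
    ∃ φ : Conv (ι ⊕ τ) K ≃ₐ[K] Conv (ι ⊕ τ) K,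
      φ (∑ i, a i • X (Sum.inl i) ^ 2 + inclR g) = ∑ i, a i • X (Sum.inl i) ^ 2 + inclR g +
          ∑ i, ∑ j, X (Sum.inl i) * X (Sum.inl j) * E i j := by
  classical
  -- Solves W + Wᵀ(4D)⁻¹W = E, D = diag(a), for a matrix W of series; it is solvable near W = 0
  -- because E(0) = 0 and the linear part in W is the identity.
  obtain ⟨ρ, hρ, hρP⟩ := exists_implicit (K := K) (ι := ι × ι) (τ := ι ⊕ τ)
    (fun z => X (Sum.inl z) + ∑ c, (4 * a c)⁻¹ • (X (Sum.inl (c, z.1)) * X (Sum.inl (c, z.2)))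
      - inclR (E z.1 z.2)) (fun z => by simp [hE]) (fun z w => by
        rw [map_sub, lin_inl_inclR]
        simp [lin_mul, eq_comm])
  set W : ι → ι → Conv (ι ⊕ τ) K := fun i j => ρ (X (Sum.inl (i, j))) with hW
  have hWE : ∀ i j, E i j = W i j + ∑ c, (4 * a c)⁻¹ • (W c i * W c j) := by
    intro i j
    have h := hρP (i, j)
    simp only [map_sub, map_add, map_sum, map_smul, map_mul, hρ] at h
    exact (sub_eq_zero.mp h).symm
  let A : ι → Conv (ι ⊕ τ) K :=
    fun i => X (Sum.inl i) + (2 * a i)⁻¹ • ∑ j, W i j * X (Sum.inl j)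
  let s : Conv (ι ⊕ τ) K →ₐ[K] Conv (ι ⊕ τ) K :=
    subst (Sum.elim A fun j => X (Sum.inr j)) (by rintro (i | j) <;> simp [A])
  obtain ⟨φ, hφ⟩ := exists_algEquiv_of_sub_mem s (by
      rintro (i | j)
      · rw [subst_X, Sum.elim_inl, add_sub_cancel_left]
        refine Submodule.smul_of_tower_mem _ _ (Ideal.sum_mem _ fun j _ => ?_)
        rw [pow_two]
        exact Ideal.mul_mem_mul (map_mem_maxIdeal ρ (X_mem_maxIdeal _)) (X_mem_maxIdeal _)
      · rw [subst_X, Sum.elim_inr, sub_self]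
        exact Ideal.zero_mem _)
  refine ⟨φ, ?_⟩
  have hg : φ (inclR g) = inclR g := by
    rw [hφ]
    exact algHom_apply_eq (φ := s.comp inclR) (ψ := inclR) (fun j => by simp [s]) g
  have hA : ∀ i, φ (X (Sum.inl i)) = A i := fun i => by rw [hφ, subst_X, Sum.elim_inl]
  rw [map_add, hg, map_sum]
  simp only [map_smul, map_pow, hA]
  rw [add_right_comm]
  congr 1
  simp only [hWE]
  exact sum_sq_complete_identity ha _ W

/-- The splitting of a series whose quadratic part is diagonal. -/
theorem exists_splitting {a : ι → K} (ha : ∀ i, a i ≠ 0) {h : Conv (ι ⊕ τ) K}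
    (hh : h ∈ maxIdeal (ι ⊕ τ) K ^ 3) :
    ∃ g ∈ maxIdeal τ K ^ 3, RightEquiv (∑ i, a i • X (Sum.inl i) ^ 2 + h)
      (∑ i, a i • X (Sum.inl i) ^ 2 + inclR g) := by
  obtain ⟨φ, g, hg, E, hE, hφ⟩ := exists_shift ha hh
  obtain ⟨ψ, hψ⟩ := exists_complete_square ha g hE
  refine ⟨g, hg, φ.trans ψ.symm, ?_⟩
  rw [AlgEquiv.trans_apply, hφ, ← hψ, AlgEquiv.symm_apply_apply]

end Existence

/-! ### Derivatives along x = 0, Taylor expansion and the square of the Jacobian ideal. -/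

section TransversalDerivative

variable {K : Type*} [NormedField K] {ι τ : Type*}

/-- The factor produced by differentiation is 1, because x_j does not occur in a monomial in y. -/
theorem coeff_killCompl_pderiv (f : MvPowerSeries (ι ⊕ τ) K) (j : ι) (β : τ →₀ ℕ) :
    coeff β (killCompl Function.Embedding.inr (pderiv K (Sum.inl j) f)) =
      coeff (Finsupp.embDomain Function.Embedding.inr β + Finsupp.single (Sum.inl j) 1) f := by
  rw [coeff_killCompl, coeff_pderiv, Finsupp.embDomain_of_notMem_range _ _ _ (by simp)]
  simp

theorem isConvergent_killCompl_pderiv (f : Conv (ι ⊕ τ) K) (j : ι) :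
    IsConvergent (killCompl Function.Embedding.inr
      (pderiv K (Sum.inl j) (f : MvPowerSeries (ι ⊕ τ) K))) := by
  obtain ⟨ε, hε, hs⟩ := f.2
  refine ⟨ε ∘ Sum.inr, fun i => hε _, ?_⟩
  have hinj : Function.Injective fun β : τ →₀ ℕ =>
      Finsupp.embDomain Function.Embedding.inr β + Finsupp.single (Sum.inl j : ι ⊕ τ) 1 :=
    (add_left_injective _).comp (Finsupp.embDomain_injective _)
  refine ((hs.comp_injective hinj).mul_right (ε (Sum.inl j))⁻¹).congr fun β => ?_
  rw [coeff_killCompl_pderiv]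
  simp only [Function.comp_apply]
  rw [Finsupp.prod_add_index' (fun _ => pow_zero _) (fun _ _ _ => pow_add _ _ _),
    Finsupp.prod_embDomain]
  have := (hε (Sum.inl j)).ne'
  simp [mul_assoc, this]

/-- The derivative with respect to `x_j` along `x = 0`. -/
def transDeriv (j : ι) : Conv (ι ⊕ τ) K →ₗ[K] Conv τ K where
  toFun f := ⟨_, isConvergent_killCompl_pderiv f j⟩
  map_add' f g := Subtype.ext (by simp)
  map_smul' c f := Subtype.ext (by simp)

theorem coe_transDeriv (j : ι) (f : Conv (ι ⊕ τ) K) :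
    (transDeriv j f : MvPowerSeries τ K) = killCompl Function.Embedding.inr
      (pderiv K (Sum.inl j) (f : MvPowerSeries (ι ⊕ τ) K)) := rfl

theorem transDeriv_mul (j : ι) (f g : Conv (ι ⊕ τ) K) :
    transDeriv j (f * g) = resR f * transDeriv j g + resR g * transDeriv j f := by
  refine Subtype.ext ?_
  change killCompl Function.Embedding.inr (pderiv K (Sum.inl j)
    ((f : MvPowerSeries (ι ⊕ τ) K) * (g : MvPowerSeries (ι ⊕ τ) K))) = _
  rw [Derivation.leibniz, map_add, smul_eq_mul, smul_eq_mul, map_mul, map_mul]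
  rfl

theorem transDeriv_inclR (j : ι) (f : Conv τ K) :
    transDeriv j (inclR f : Conv (ι ⊕ τ) K) = 0 := by
  refine ext_coeff fun β => ?_
  rw [coe_transDeriv, coeff_killCompl_pderiv]
  refine coeff_rename_eq_zero _ _ ?_
  rintro ⟨α, hα⟩
  have h := DFunLike.congr_fun hα (Sum.inl j)
  rw [Finsupp.mapDomain_of_notMem_range _ _ (by simp)] at h
  simp at h

theorem valZero_transDeriv (j : ι) (f : Conv (ι ⊕ τ) K) :
    valZero (transDeriv j f) = lin (Sum.inl j) f := by
  rw [valZero_apply, ← coeff_zero_eq_constantCoeff_apply, coe_transDeriv, coeff_killCompl_pderiv,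
    lin_apply]
  simp

end TransversalDerivative

section Taylor

variable {K : Type*} [RCLike K] {σ τ : Type*} [Fintype σ] [Fintype τ]

/-- The substitution `g(y) ↦ g(y + v)`. -/
def translate : Conv τ K →ₐ[K] Conv (τ ⊕ τ) K :=
  subst (fun j => X (Sum.inr j) + X (Sum.inl j)) (by simp)

/-- Dividing g(y+v) twice by the displacement variables v. The p_l play the role of ∂g/∂y_l and are
used only through this expansion; order three of g gives p_l order two and makes the G_lm vanish at
0. -/
theorem exists_taylor {g : Conv τ K} (hg : g ∈ maxIdeal τ K ^ 3) :
    ∃ (p : τ → Conv τ K) (G : τ → τ → Conv (τ ⊕ τ) K), (∀ l, p l ∈ maxIdeal τ K ^ 2) ∧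
      (∀ l m, valZero (G l m) = 0) ∧
      translate g = inclR g + ∑ l, X (Sum.inl l) *
        (inclR (p l) + ∑ m, X (Sum.inl m) * G l m) := by
  obtain ⟨q, hq, hqord⟩ := exists_relative_division (translate g)
  choose G hG hGord using fun i => exists_relative_division (q i)
  have hq2 := hqord 2 (map_mem_maxIdeal_pow _ hg)
  refine ⟨fun l => resR (q l), G, fun l => map_mem_maxIdeal_pow _ (hq2 l), fun l m => ?_, ?_⟩
  · refine valZero_eq_zero_of_mem ?_
    rw [← pow_one (maxIdeal (τ ⊕ τ) K)]
    exact hGord l 1 (hq2 l) m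
  · have h : resR (translate g) = g :=
      algHom_apply_eq (φ := resR.comp translate) (ψ := AlgHom.id K _)
        (fun j => by simp [translate]) g
    rw [h] at hq
    rw [hq]
    congr 1
    exact Finset.sum_congr rfl fun l _ => by rw [← hG]

/-- The increment of g in its Taylor expansion at displacement v_l = Σ_a w_la p_a is a quadratic
form in p; the condition on w says that its matrix is c. -/
theorem sum_quadratic_identity {A : Type*} [CommRing A] (p : τ → A) (c w H : τ → τ → A)
    (hw : ∀ a b, w a b + ∑ l, ∑ m, H l m * (w l a * w m b) = c a b) :
    ∑ l, (∑ a, w l a * p a) * (p l + ∑ m, (∑ a, w m a * p a) * H l m) =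
      ∑ l, ∑ m, c l m * (p l * p m) := by
  have h1 : ∑ l, (∑ a, w l a * p a) * ∑ m, (∑ a, w m a * p a) * H l m =
      ∑ a, ∑ b, (∑ l, ∑ m, H l m * (w l a * w m b)) * (p a * p b) := by
    have h2 : ∀ l m, (∑ a, w l a * p a) * ((∑ a, w m a * p a) * H l m) =
        ∑ a, ∑ b, (H l m * (w l a * w m b)) * (p a * p b) := by
      intro l m
      rw [← mul_assoc, Finset.sum_mul_sum, Finset.sum_mul]
      refine Finset.sum_congr rfl fun a _ => ?_
      rw [Finset.sum_mul]
      exact Finset.sum_congr rfl fun b _ => by ring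
    have h4 : ∀ l, (∑ a, w l a * p a) * ∑ m, (∑ a, w m a * p a) * H l m =
        ∑ m, ∑ a, ∑ b, (H l m * (w l a * w m b)) * (p a * p b) := by
      intro l
      rw [Finset.mul_sum]
      exact Finset.sum_congr rfl fun m _ => h2 l m
    rw [Finset.sum_congr rfl fun l _ => h4 l]
    calc ∑ l, ∑ m, ∑ a, ∑ b, H l m * (w l a * w m b) * (p a * p b)
        = ∑ l, ∑ a, ∑ m, ∑ b, H l m * (w l a * w m b) * (p a * p b) :=
          Finset.sum_congr rfl fun l _ => Finset.sum_comm
      _ = ∑ a, ∑ l, ∑ m, ∑ b, H l m * (w l a * w m b) * (p a * p b) := Finset.sum_comm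
      _ = ∑ a, ∑ l, ∑ b, ∑ m, H l m * (w l a * w m b) * (p a * p b) :=
          Finset.sum_congr rfl fun a _ => Finset.sum_congr rfl fun l _ => Finset.sum_comm
      _ = ∑ a, ∑ b, ∑ l, ∑ m, H l m * (w l a * w m b) * (p a * p b) :=
          Finset.sum_congr rfl fun a _ => Finset.sum_comm
      _ = _ := Finset.sum_congr rfl fun a _ => Finset.sum_congr rfl fun b _ => by
          rw [Finset.sum_mul]
          exact Finset.sum_congr rfl fun l _ => by rw [Finset.sum_mul]
  have h3 : ∑ l, (∑ a, w l a * p a) * p l = ∑ l, ∑ m, w l m * (p l * p m) := by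
    refine Finset.sum_congr rfl fun l _ => ?_
    rw [Finset.sum_mul]
    exact Finset.sum_congr rfl fun b _ => by ring
  rw [Finset.sum_congr rfl fun l _ => mul_add _ _ _, Finset.sum_add_distrib, h1, h3,
    ← Finset.sum_add_distrib]
  refine Finset.sum_congr rfl fun l _ => ?_
  rw [← Finset.sum_add_distrib]
  exact Finset.sum_congr rfl fun m _ => by rw [← hw, add_mul]

/-- Adding an element of the square of the Jacobian ideal does not change the right equivalence
class of a series of order at least three. -/
theorem rightEquiv_add_sum_mul {g : Conv τ K} {p : τ → Conv τ K} {G : τ → τ → Conv (τ ⊕ τ) K}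
    (hp : ∀ l, p l ∈ maxIdeal τ K ^ 2) (hG : ∀ l m, valZero (G l m) = 0)
    (hT : translate g = inclR g + ∑ l, X (Sum.inl l) *
        (inclR (p l) + ∑ m, X (Sum.inl m) * G l m)) (c : τ → τ → Conv τ K) :
    RightEquiv g (g + ∑ l, ∑ m, c l m * (p l * p m)) := by
  classical
  have hp0 : ∀ l, valZero (p l) = 0 := fun l =>
    valZero_eq_zero_of_mem (Ideal.pow_le_self two_ne_zero (hp l))
  -- The unknown matrix is centred at c, so that the new variables vanish at the solution over the
  -- origin.
  let U : τ → τ → Conv ((τ × τ) ⊕ τ) K := fun l m => inclR (c l m) + X (Sum.inl (l, m))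
  let θ : Conv (τ ⊕ τ) K →ₐ[K] Conv ((τ × τ) ⊕ τ) K :=
    subst (Sum.elim (fun l => ∑ m, U l m * inclR (p m)) fun j => X (Sum.inr j))
      (by rintro (l | j) <;> simp [hp0])
  have hθl : ∀ l, θ (X (Sum.inl l)) = ∑ m, U l m * inclR (p m) := fun l => by simp [θ]
  have hθr : ∀ j, θ (X (Sum.inr j)) = X (Sum.inr j) := fun l => by simp [θ]
  -- The unknowns enter θ f only through products with the p_m, which vanish at 0.
  have hθG : ∀ z f, lin (Sum.inl z) (θ f) = 0 := by
    intro z f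
    rw [lin_map]
    refine Finset.sum_eq_zero fun y _ => ?_
    rcases y with l | j
    · rw [hθl]
      simp [lin_mul, lin_inl_inclR, hp0]
    · rw [hθr]
      simp
  obtain ⟨ρ, hρ, hρP⟩ := exists_implicit (K := K) (ι := τ × τ) (τ := τ)
    (fun z => X (Sum.inl z) + ∑ l, ∑ m, θ (G l m) * (U l z.1 * U m z.2))
    (fun z => by simp [hG]) (fun z w => by
      rw [map_add]
      simp only [map_sum]
      rw [Finset.sum_eq_zero fun l _ => Finset.sum_eq_zero fun m _ => ?_]
      · simp [eq_comm]
      · rw [lin_mul, hθG, valZero_map, hG]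
        simp)
  set w : τ → τ → Conv τ K := fun l m => ρ (U l m) with hw
  have hwU : ∀ l m, w l m = c l m + ρ (X (Sum.inl (l, m))) := fun l m => by
    simp only [hw, U, map_add, hρ]
  have hwc : ∀ a b, w a b + ∑ l, ∑ m, ρ (θ (G l m)) * (w l a * w m b) = c a b := by
    intro a b
    have h := hρP (a, b)
    simp only [map_add, map_sum, map_mul] at h
    rw [hwU a b, add_assoc]
    simpa [hw] using h
  have hΘl : ∀ l, ρ (θ (X (Sum.inl l))) = ∑ m, w l m * p m := fun l => by
    simp only [hθl, map_sum, map_mul, hρ, hw]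
  have hΘr : ∀ f, ρ (θ (inclR f)) = f := fun f =>
    algHom_apply_eq (φ := (ρ.comp θ).comp inclR) (ψ := AlgHom.id K _) (fun j => by
      have := hρ (X j)
      rw [inclR_X] at this
      simp [hθr, this]) f
  -- The displacement is a combination of the p_m, which have order two, so y ↦ y + v is the
  -- identity to first order.
  obtain ⟨ψ, hψ⟩ := exists_algEquiv_of_sub_mem ((ρ.comp θ).comp translate) (fun j => by
    have h : translate (X j : Conv τ K) = inclR (X j) + X (Sum.inl j) := by simp [translate]
    rw [AlgHom.comp_apply, h, AlgHom.comp_apply, map_add, map_add, hΘr, hΘl, add_sub_cancel_left]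
    exact Ideal.sum_mem _ fun m _ => Ideal.mul_mem_left _ _ (hp m))
  refine ⟨ψ, ?_⟩
  rw [hψ, AlgHom.comp_apply, hT, AlgHom.comp_apply]
  simp only [map_add, map_sum, map_mul, hΘr, hΘl]
  rw [sum_quadratic_identity p c w _ hwc]

end Taylor

/-! ### Uniqueness of the residual part. -/

section Uniqueness

variable {K : Type*} [RCLike K] {ι τ : Type*} [Fintype ι] [Fintype τ]

theorem hessian_smul_sq {σ : Type*} (c : K) {f : Conv σ K} (hf : valZero f = 0) (i j : σ) :
    hessian (c • f ^ 2) i j = 2 * c * (lin i f * lin j f) := by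
  rw [hessian_smul, Matrix.smul_apply, pow_two, hessian_mul_of_valZero hf hf, smul_eq_mul]
  ring

theorem hessian_sum_smul_sq {σ : Type*} (c : ι → K) {f : ι → Conv σ K}
    (hf : ∀ k, valZero (f k) = 0) (i j : σ) :
    hessian (∑ k, c k • f k ^ 2) i j = ∑ k, 2 * c k * (lin i (f k) * lin j (f k)) := by
  rw [hessian_sum, Matrix.sum_apply]
  exact Finset.sum_congr rfl fun k _ => hessian_smul_sq _ (hf k) i j

theorem lin_resR [DecidableEq ι] [DecidableEq τ] (j : τ) (f : Conv (ι ⊕ τ) K) :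
    lin j (resR f) = lin (Sum.inr j) f := by
  rw [lin_map]
  simp

/-- The derivative of `g(B)` with respect to `x_j` along `x = 0`. -/
theorem transDeriv_map {g : Conv τ K} {p : τ → Conv τ K} {G : τ → τ → Conv (τ ⊕ τ) K}
    (hT : translate g = inclR g + ∑ l, X (Sum.inl l) *
        (inclR (p l) + ∑ m, X (Sum.inl m) * G l m))
    (φ : Conv τ K →ₐ[K] Conv (ι ⊕ τ) K) (j : ι) :
    transDeriv j (φ g) = ∑ l, transDeriv j (φ (X l)) * resR (φ (p l)) := by
  let φ₀ : Conv τ K →ₐ[K] Conv (ι ⊕ τ) K := inclR.comp (resR.comp φ)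
  have hφ₀ : ∀ f, φ₀ f = inclR (resR (φ f)) := fun _ => rfl
  -- Taylor expansion about B(0,y) with displacement B(x,y) − B(0,y), where B is the image of y
  -- under φ. The displacement vanishes at x = 0, so the second-order terms do not contribute.
  let Θ : Conv (τ ⊕ τ) K →ₐ[K] Conv (ι ⊕ τ) K :=
    subst (Sum.elim (fun l => φ (X l) - φ₀ (X l)) fun l => φ₀ (X l))
      (by rintro (l | l) <;> simp)
  have hΘl : ∀ l, Θ (X (Sum.inl l)) = φ (X l) - φ₀ (X l) := fun l => by simp [Θ]
  have hΘr : ∀ l, Θ (X (Sum.inr l)) = φ₀ (X l) := fun l => by simp [Θ]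
  have hΘi : ∀ f, Θ (inclR f) = φ₀ f := fun f =>
    algHom_apply_eq (φ := Θ.comp inclR) (ψ := φ₀) (fun l => by simp [hΘr]) f
  have hΘT : Θ (translate g) = φ g :=
    algHom_apply_eq (φ := Θ.comp translate) (ψ := φ)
      (fun l => by simp [translate, hΘl, hΘr]) g
  have hres : ∀ l, resR (φ (X l) - φ₀ (X l)) = 0 := fun l => by
    rw [map_sub, hφ₀, res_incl, sub_self]
  rw [← hΘT, hT]
  simp only [map_add, map_sum, map_mul, hΘl, hΘi, transDeriv_mul, hres]
  rw [hφ₀, transDeriv_inclR, zero_add]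
  refine Finset.sum_congr rfl fun l _ => ?_
  rw [zero_mul, zero_add, hφ₀, res_incl, map_sub, hφ₀, transDeriv_inclR, sub_zero]
  simp only [zero_mul, Finset.sum_const_zero, add_zero]
  rw [mul_comm]

/-- Restriction to x = 0 gives g' = β(g) + Σ a_i A_i(0,y)², and the vanishing of the x-derivatives
there puts A_i(0,y) in the image under β of the ideal of the p_l. The extra sum thus lies in the
square of that ideal. -/
theorem rightEquiv_residual {a a' : ι → K} (ha' : ∀ i, a' i ≠ 0)
    {g g' : Conv τ K} (hg : g ∈ maxIdeal τ K ^ 3) (hg' : g' ∈ maxIdeal τ K ^ 3)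
    (h : RightEquiv (∑ i, a i • X (Sum.inl i) ^ 2 + inclR g : Conv (ι ⊕ τ) K)
      (∑ i, a' i • X (Sum.inl i) ^ 2 + inclR g')) :
    RightEquiv g g' := by
  classical
  obtain ⟨φ, hφ⟩ := h
  set A : ι → Conv (ι ⊕ τ) K := fun i => φ (X (Sum.inl i)) with hA
  let φR : Conv τ K →ₐ[K] Conv (ι ⊕ τ) K := φ.toAlgHom.comp inclR
  let β : Conv τ K →ₐ[K] Conv τ K := resR.comp φR
  have hA0 : ∀ i, valZero (A i) = 0 := fun i =>
    (valZero_map φ.toAlgHom (X (Sum.inl i))).trans (valZero_X _)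
  have heq : ∑ i, a i • A i ^ 2 + φR g = ∑ i, a' i • X (Sum.inl i) ^ 2 + inclR g' := by
    rw [← hφ, map_add, map_sum]
    simp only [map_smul, map_pow]
    rfl
  -- the quadratic parts
  have hess : ∀ z w, ∑ i, 2 * a i * (lin z (A i) * lin w (A i)) =
      ∑ i, 2 * a' i * (lin z (X (Sum.inl i) : Conv (ι ⊕ τ) K) * lin w (X (Sum.inl i))) := by
    intro z w
    rw [← hessian_sum_smul_sq a hA0, ← hessian_sum_smul_sq a' (fun i => valZero_X _)]
    have h1 := congrArg hessian heq
    rw [hessian_add, hessian_add, hessian_eq_zero_of_mem (map_mem_maxIdeal_pow φR hg),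
      hessian_eq_zero_of_mem (map_mem_maxIdeal_pow inclR hg'), add_zero, add_zero] at h1
    rw [h1]
  let M : Matrix ι ι K := Matrix.of fun i j => lin (Sum.inl j) (A i)
  let N : Matrix ι τ K := Matrix.of fun i j => lin (Sum.inr j) (A i)
  let D : Matrix ι ι K := Matrix.diagonal fun i => 2 * a i
  have hMM : M.transpose * D * M = Matrix.diagonal fun i => 2 * a' i := by
    refine Matrix.ext fun j k => ?_
    have h1 := hess (Sum.inl j) (Sum.inl k)
    rw [Matrix.mul_apply]
    simp only [D, Matrix.mul_diagonal, Matrix.transpose_apply, M, Matrix.of_apply]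
    rw [Matrix.diagonal_apply]
    refine Eq.trans (Finset.sum_congr rfl fun i _ => by ring) (h1.trans ?_)
    simp
    grind
  have hMN : M.transpose * D * N = 0 := by
    refine Matrix.ext fun j k => ?_
    have h1 := hess (Sum.inl j) (Sum.inr k)
    rw [Matrix.mul_apply]
    simp only [D, Matrix.mul_diagonal, Matrix.transpose_apply, M, N, Matrix.of_apply]
    refine Eq.trans (Finset.sum_congr rfl fun i _ => by ring) (h1.trans ?_)
    simp
  -- MᵀDM = diag(2a') is invertible, hence so is MᵀD, and MᵀDN = 0 forces N = 0. The Jacobian of φ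
  -- is then block triangular, with the Jacobian of β as a diagonal block.
  have hdet : IsUnit (M.transpose * D).det := by
    have h1 := congrArg Matrix.det hMM
    rw [Matrix.det_mul, Matrix.det_diagonal] at h1
    rw [isUnit_iff_ne_zero]
    intro h2
    rw [h2, zero_mul] at h1
    exact Finset.prod_ne_zero_iff.mpr (fun i _ => mul_ne_zero two_ne_zero (ha' i)) h1.symm
  have hN : N = 0 := by
    rw [← Matrix.nonsing_inv_mul_cancel_left (A := M.transpose * D) N hdet, hMN, Matrix.mul_zero]
  -- the residual coordinate change
  have hβdet : IsUnit (jacobian fun l => β (X l)).det := by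
    have h1 := isUnit_det_jacobian φ
    have h2 : (jacobian fun z => φ (X z)) = Matrix.fromBlocks M 0
        (Matrix.of fun l j => lin (Sum.inl j) (φ (X (Sum.inr l)))) (jacobian fun l => β (X l)) := by
      refine Matrix.ext fun z w => ?_
      rcases z with i | l <;> rcases w with j | m
      · rfl
      · exact congrFun (congrFun hN i) m
      · rfl
      · change lin (Sum.inr m) (φ (X (Sum.inr l))) = lin m (β (X l))
        rw [AlgHom.comp_apply, lin_resR, AlgHom.comp_apply, inclR_X]
        rfl
    rw [h2, Matrix.det_fromBlocks_zero₁₂] at h1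
    exact isUnit_of_mul_isUnit_right h1
  obtain ⟨β', hβ'⟩ := exists_algEquiv_of_isUnit_det β hβdet
  -- the derivatives along the critical locus
  obtain ⟨p, G, hp, hG, hT⟩ := exists_taylor hg
  -- The x_j-derivatives of the identity `heq` along x = 0 form the system Q·A(0,y) = −R·β(p). The
  -- value of Q at the origin is MᵀD, so Q is invertible over the ring of series.
  let Q : Matrix ι ι (Conv τ K) := Matrix.of fun j i => (2 * a i) • transDeriv j (A i)
  let R : Matrix ι τ (Conv τ K) := Matrix.of fun j l => transDeriv j (φR (X l))
  have hQ : IsUnit Q.det := by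
    refine isUnit_of_valZero_ne_zero ?_
    rw [AlgHom.map_det]
    have h1 : (valZero : Conv τ K →ₐ[K] K).mapMatrix Q = M.transpose * D := by
      refine Matrix.ext fun j i => ?_
      rw [Matrix.mul_diagonal]
      change valZero ((2 * a i) • transDeriv j (A i)) = lin (Sum.inl j) (A i) * (2 * a i)
      rw [map_smul, valZero_transDeriv, smul_eq_mul, mul_comm]
    rw [h1]
    exact hdet.ne_zero
  have hQA : Q.mulVec (fun i => resR (A i)) = -R.mulVec fun l => β (p l) := by
    funext j
    have h1 := congrArg (transDeriv j) heq
    simp only [map_add, map_sum, map_smul, pow_two, transDeriv_mul, resR_X_inl, transDeriv_inclR,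
      transDeriv_map hT φR j] at h1
    rw [Pi.neg_apply, eq_neg_iff_add_eq_zero]
    refine Eq.trans ?_ (h1.trans (by simp))
    refine congrArg₂ (· + ·) (Finset.sum_congr rfl fun i _ => ?_) rfl
    change ((2 * a i) • transDeriv j (A i)) * resR (A i) = _
    simp only [Algebra.smul_def, map_mul, map_ofNat]
    ring
  let C : Matrix ι τ (Conv τ K) := -(Q⁻¹ * R)
  have hAC : ∀ i, resR (A i) = ∑ l, C i l * β (p l) := by
    have h1 : (fun i => resR (A i)) = C.mulVec fun l => β (p l) := by
      have h2 := congrArg Q⁻¹.mulVec hQA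
      rw [Matrix.mulVec_mulVec, Matrix.nonsing_inv_mul _ hQ, Matrix.one_mulVec] at h2
      rw [h2, Matrix.mulVec_neg, Matrix.mulVec_mulVec, Matrix.neg_mulVec]
    exact fun i => congrFun h1 i
  -- The coefficients are pulled back by β, so that applying β to the modified series yields g'.
  obtain ⟨ψ, hψ⟩ := rightEquiv_add_sum_mul hp hG hT
    fun l m => ∑ i, a i • (β'.symm (C i l) * β'.symm (C i m))
  refine ⟨ψ.trans β', ?_⟩
  have hres := congrArg resR heq
  simp only [map_add, map_sum, map_smul, map_pow, resR_X_inl, res_incl] at hres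
  have hres' : g' = ∑ i, a i • (∑ l, C i l * β (p l)) ^ 2 + β g := by
    rw [← Finset.sum_congr rfl fun i _ => congrArg (fun t => a i • t ^ 2) (hAC i)]
    have h1 : g' = ∑ i, a i • resR (A i) ^ 2 + resR (φR g) := by simpa using hres.symm
    exact h1
  rw [AlgEquiv.trans_apply, hψ, hres', map_add, hβ', add_comm]
  congr 1
  have hβs : ∀ f, β (β'.symm f) = f := fun f => by rw [← hβ', AlgEquiv.apply_symm_apply]
  simp only [map_sum, map_mul, map_smul, hβ', hβs]
  have e1 : ∀ i, a i • (∑ l, C i l * β (p l)) ^ 2 =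
      ∑ l, ∑ m, a i • (C i l * C i m) * (β (p l) * β (p m)) := by
    intro i
    rw [pow_two, Finset.sum_mul_sum, Finset.smul_sum]
    refine Finset.sum_congr rfl fun l _ => ?_
    rw [Finset.smul_sum]
    refine Finset.sum_congr rfl fun m _ => ?_
    simp only [Algebra.smul_def]
    ring
  refine Eq.symm ((Finset.sum_congr rfl fun i _ => e1 i).trans (Finset.sum_comm.trans ?_))
  refine Finset.sum_congr rfl fun l _ => Finset.sum_comm.trans ?_
  exact Finset.sum_congr rfl fun m _ => by rw [Finset.sum_mul]

end Uniqueness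

/-! ### The quadratic part: Hessians and diagonalisation. -/

section QuadraticPart

variable {K : Type*} [NontriviallyNormedField K] {σ τ : Type*} [Fintype σ]

theorem exists_quadratic_part {f : Conv σ K} (hf : f ∈ maxIdeal σ K ^ 2) :
    ∃ (c : σ → σ → K) (h : Conv σ K), h ∈ maxIdeal σ K ^ 3 ∧
      f = ∑ i, ∑ j, c i j • (X i * X j) + h := by
  obtain ⟨q, hq, hqord⟩ := exists_eq_sum_X_mul f
  have hq1 := hqord 1 hf
  choose r hr _ using fun i => exists_eq_sum_X_mul (q i)
  refine ⟨fun i j => valZero (r i j),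
    ∑ i, ∑ j, X i * X j * (r i j - algebraMap K _ (valZero (r i j))), ?_, ?_⟩
  · refine Ideal.sum_mem _ fun i _ => Ideal.sum_mem _ fun j _ => ?_
    rw [pow_succ, pow_two]
    refine Ideal.mul_mem_mul (Ideal.mul_mem_mul (X_mem_maxIdeal i) (X_mem_maxIdeal j))
      (mem_maxIdeal_iff.mpr ?_)
    rw [map_sub, AlgHom.commutes, Algebra.algebraMap_self_apply, sub_self]
  · have hf0 : valZero f = 0 :=
      valZero_eq_zero_of_mem (Ideal.pow_le_self two_ne_zero hf)
    have hq0 : ∀ i, valZero (q i) = 0 := fun i =>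
      valZero_eq_zero_of_mem (by simpa using hq1 i)
    conv_lhs => rw [hq, hf0, map_zero, zero_add]
    rw [← Finset.sum_add_distrib]
    refine Finset.sum_congr rfl fun i _ => ?_
    conv_lhs => rw [hr i, hq0, map_zero, zero_add]
    rw [← Finset.sum_add_distrib, Finset.mul_sum]
    refine Finset.sum_congr rfl fun j _ => ?_
    rw [Algebra.smul_def]
    ring

theorem hessian_quadratic {c : σ → σ → K} {P : σ → Conv τ K} (hP : ∀ i, valZero (P i) = 0)
    {h : Conv τ K} (hh : h ∈ maxIdeal τ K ^ 3) (z w : τ) :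
    hessian (∑ i, ∑ j, c i j • (P i * P j) + h) z w =
      ∑ i, ∑ j, (c i j + c j i) * (lin z (P i) * lin w (P j)) := by
  rw [hessian_add, hessian_eq_zero_of_mem hh, add_zero, hessian_sum, Matrix.sum_apply]
  simp only [hessian_sum, Matrix.sum_apply, hessian_smul, Matrix.smul_apply,
    hessian_mul_of_valZero (hP _) (hP _), smul_eq_mul, mul_add, add_mul, Finset.sum_add_distrib]
  congr 1
  rw [Finset.sum_comm]
  exact Finset.sum_congr rfl fun i _ => Finset.sum_congr rfl fun j _ => by ring

theorem hessian_quadratic_X [DecidableEq σ] {c : σ → σ → K} {h : Conv σ K}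
    (hh : h ∈ maxIdeal σ K ^ 3) (i j : σ) :
    hessian (∑ i, ∑ j, c i j • (X i * X j) + h) i j = c i j + c j i := by
  rw [hessian_quadratic (fun i => valZero_X i) hh]
  simp

theorem hessian_symm {f : Conv σ K} (hf : f ∈ maxIdeal σ K ^ 2) (i j : σ) :
    hessian f i j = hessian f j i := by
  classical
  obtain ⟨c, h, hh, rfl⟩ := exists_quadratic_part hf
  rw [hessian_quadratic_X hh, hessian_quadratic_X hh, add_comm]

/-- The Hessian is c + cᵀ, and twice the quadratic part is the form with this matrix, so in
characteristic zero the quadratic part vanishes. -/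
theorem mem_maxIdeal_cube_of_hessian [CharZero K] {f : Conv σ K} (hf : f ∈ maxIdeal σ K ^ 2)
    (h0 : hessian f = 0) : f ∈ maxIdeal σ K ^ 3 := by
  classical
  obtain ⟨c, h, hh, rfl⟩ := exists_quadratic_part hf
  refine Ideal.add_mem _ ?_ hh
  have hc : ∀ i j, c i j + c j i = 0 := fun i j => by
    rw [← hessian_quadratic_X hh, h0]
    rfl
  have h2 : (2 : K) • ∑ i, ∑ j, c i j • (X i * X j : Conv σ K) = 0 := by
    rw [two_smul]
    nth_rewrite 2 [Finset.sum_comm]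
    rw [← Finset.sum_add_distrib]
    refine Finset.sum_eq_zero fun i _ => ?_
    rw [← Finset.sum_add_distrib]
    refine Finset.sum_eq_zero fun j _ => ?_
    rw [mul_comm (X j) (X i), ← add_smul, hc, zero_smul]
  rw [(smul_eq_zero.mp h2).resolve_left two_ne_zero]
  exact Ideal.zero_mem _

variable [CompleteSpace K] [Fintype τ]

/-- The chain rule for Hessians at a critical point. -/
theorem hessian_map (φ : Conv σ K →ₐ[K] Conv τ K) {f : Conv σ K} (hf : f ∈ maxIdeal σ K ^ 2)
    (z w : τ) : hessian (φ f) z w =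
      ∑ i, ∑ j, hessian f i j * (lin z (φ (X i)) * lin w (φ (X j))) := by
  classical
  obtain ⟨c, h, hh, rfl⟩ := exists_quadratic_part hf
  simp only [hessian_quadratic_X hh]
  rw [← hessian_quadratic (fun i => (valZero_map φ (X i)).trans (valZero_X i))
    (map_mem_maxIdeal_pow φ hh)]
  simp only [map_add, map_sum, map_smul, map_mul]

end QuadraticPart

section Diagonalisation

open Module

variable {K : Type*} [Field K] [CharZero K] {ι τ σ : Type*} [Fintype ι] [Fintype τ] [Fintype σ]
  [DecidableEq ι] [DecidableEq τ] [DecidableEq σ]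

/-- A symmetric matrix is congruent to a diagonal one whose non-zero entries come first. -/
theorem exists_basis_diagonal {H : Matrix σ σ K} (hH : H.IsSymm) (hrank : H.rank = Fintype.card ι)
    (hcard : Fintype.card σ = Fintype.card ι + Fintype.card τ) {S : K → Prop}
    (hS : ∀ c : K, c ≠ 0 → ∃ s d, S s ∧ c = s * d ^ 2) :
    ∃ (u : Basis (ι ⊕ τ) K (σ → K)) (a : ι → K), (∀ i, S (a i) ∧ a i ≠ 0) ∧
      ∀ z w, Matrix.toBilin' H (u z) (u w) =
        Matrix.diagonal (Sum.elim a fun _ => 0) z w := by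
  classical
  have : Invertible (2 : K) := invertibleOfNonzero two_ne_zero
  have hsymm : (Matrix.toBilin' H).IsSymm := Matrix.isSymm_toBilin'_iff_isSymm.mpr hH
  obtain ⟨v₀, hv₀⟩ := LinearMap.BilinForm.exists_orthogonal_basis (B := Matrix.toBilin' H)
    ⟨fun x y => hsymm.eq x y⟩
  obtain ⟨v, hv⟩ : ∃ v : Basis σ K (σ → K),
      ∀ i j, i ≠ j → Matrix.toBilin' H (v i) (v j) = 0 := by
    refine ⟨v₀.reindex (Fintype.equivOfCardEq (by simp)), fun i j hij => ?_⟩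
    rw [Basis.reindex_apply, Basis.reindex_apply]
    exact hv₀ fun h => hij (by simpa using h)
  set d : σ → K := fun j => Matrix.toBilin' H (v j) (v j) with hd
  have hdiag : ∀ i j, Matrix.toBilin' H (v i) (v j) = Matrix.diagonal d i j := by
    intro i j
    rw [Matrix.diagonal_apply]
    split_ifs with h
    · rw [h]
    · exact hv i j h
  -- Congruence by an invertible matrix preserves the rank, and the rank of a diagonal matrix counts
  -- its non-zero entries.
  have hcardd : Fintype.card {j // d j ≠ 0} = Fintype.card ι := by
    let V : Matrix σ σ K := (Pi.basisFun K σ).toMatrix v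
    have hV : IsUnit V.det := Matrix.isUnit_det_of_right_inverse
      ((Pi.basisFun K σ).toMatrix_mul_toMatrix_flip v)
    have hVH : V.transpose * (H * V) = Matrix.diagonal d := by
      refine Matrix.ext fun i j => ?_
      rw [← hdiag, Matrix.toBilin'_apply']
      rfl
    rw [← hrank, ← Matrix.rank_diagonal, ← hVH,
      Matrix.rank_mul_eq_right_of_isUnit_det _ _ (by rwa [Matrix.det_transpose]),
      Matrix.rank_mul_eq_left_of_isUnit_det _ _ hV]
  have hcardd' : Fintype.card {j // ¬ d j ≠ 0} = Fintype.card τ := by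
    rw [Fintype.card_subtype_compl, hcardd, hcard, Nat.add_sub_cancel_left]
  let ε : ι ⊕ τ ≃ σ := (Equiv.sumCongr (Fintype.equivOfCardEq hcardd.symm)
    (Fintype.equivOfCardEq hcardd'.symm)).trans (Equiv.sumCompl fun j => d j ≠ 0)
  have hεl : ∀ i, d (ε (Sum.inl i)) ≠ 0 := fun i =>
    (Fintype.equivOfCardEq hcardd.symm i : {j // d j ≠ 0}).2
  have hεr : ∀ j, d (ε (Sum.inr j)) = 0 := fun j =>
    not_not.mp (Fintype.equivOfCardEq hcardd'.symm j : {j // ¬ d j ≠ 0}).2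
  choose a s has hdas using fun i => hS _ (hεl i)
  have hs0 : ∀ i, s i ≠ 0 := fun i h => hεl i (by rw [hdas, h]; ring)
  have ha0 : ∀ i, a i ≠ 0 := fun i h => hεl i (by rw [hdas, h]; ring)
  -- The diagonal entry is a_i s_i², so scaling the basis vector by s_i⁻¹ leaves a_i.
  let t : ι ⊕ τ → Kˣ := Sum.elim (fun i => (Units.mk0 (s i) (hs0 i))⁻¹) fun _ => 1
  refine ⟨(v.reindex ε.symm).unitsSMul t, a, fun i => ⟨has i, ha0 i⟩, fun z w => ?_⟩
  rw [Basis.unitsSMul_apply, Basis.unitsSMul_apply, Units.smul_def, Units.smul_def, map_smul,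
    map_smul, LinearMap.smul_apply, Basis.reindex_apply, Basis.reindex_apply, hdiag,
    Matrix.diagonal_apply, Matrix.diagonal_apply]
  simp only [Equiv.symm_symm, EmbeddingLike.apply_eq_iff_eq]
  split_ifs with h
  · subst h
    rcases z with i | j
    · have := hs0 i
      simp only [t, Sum.elim_inl, hdas, Units.val_inv_eq_inv_val, Units.val_mk0, smul_eq_mul]
      field_simp
    · simp [hεr]
  · simp

end Diagonalisation

/-! ### Renaming of variables and the splitting for general quadratic part. -/

section RightEquiv

variable {K : Type*} [NormedField K] {σ τ : Type*}

theorem RightEquiv.symm {f g : Conv σ K} (h : RightEquiv f g) : RightEquiv g f := by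
  obtain ⟨φ, rfl⟩ := h
  exact ⟨φ.symm, φ.symm_apply_apply f⟩

theorem RightEquiv.trans {f g h : Conv σ K} (hfg : RightEquiv f g)
    (hgh : RightEquiv g h) : RightEquiv f h := by
  obtain ⟨φ, rfl⟩ := hfg
  obtain ⟨ψ, rfl⟩ := hgh
  exact ⟨φ.trans ψ, rfl⟩

theorem rightEquiv_map_iff (E : Conv σ K ≃ₐ[K] Conv τ K) {f g : Conv σ K} :
    RightEquiv (E f) (E g) ↔ RightEquiv f g := by
  constructor
  · rintro ⟨φ, hφ⟩
    exact ⟨(E.trans φ).trans E.symm, by simp [hφ]⟩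
  · rintro ⟨φ, hφ⟩
    exact ⟨(E.symm.trans φ).trans E, by simp [hφ]⟩

end RightEquiv

section Transport

variable {K : Type*} [NontriviallyNormedField K] [CompleteSpace K] {σ τ : Type*} [Fintype σ]
  [Fintype τ]

/-- Renaming the variables. -/
def inclEquiv (e : σ ≃ τ) : Conv σ K ≃ₐ[K] Conv τ K :=
  AlgEquiv.ofAlgHom (incl e.toEmbedding) (incl e.symm.toEmbedding)
    (algHom_ext fun i => by simp) (algHom_ext fun i => by simp)

theorem inclEquiv_apply (e : σ ≃ τ) (f : Conv σ K) :
    inclEquiv e f = incl e.toEmbedding f := rfl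

end Transport

section Splitting

variable {K : Type*} [RCLike K]

/-- A linear change diagonalises the Hessian; what remains beyond the squares has order three. The
predicate S describes the permitted coefficients, which represent all non-zero scalars modulo
squares: 1 over ℂ, ±1 over ℝ. -/
theorem exists_splitting_of_rank {ι τ : Type*} [Fintype ι] [Fintype τ] {f : Conv (ι ⊕ τ) K}
    (hf : f ∈ maxIdeal (ι ⊕ τ) K ^ 2) (hrank : (hessian f).rank = Fintype.card ι) {S : K → Prop}
    (hS : ∀ c : K, c ≠ 0 → ∃ s d, S s ∧ c = s * d ^ 2) :
    ∃ a : ι → K, (∀ i, S (a i)) ∧ ∃ g ∈ maxIdeal τ K ^ 3,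
      RightEquiv f (∑ i, a i • X (Sum.inl i) ^ 2 + inclR g) := by
  classical
  -- The Hessian of a x² is 2a, so the diagonal entries b of the Hessian are normalised by S(b/2).
  obtain ⟨u, b, hb, hu⟩ := exists_basis_diagonal (ι := ι) (τ := τ) (S := fun s => S (s / 2))
    (Matrix.IsSymm.ext fun i j => hessian_symm hf j i) hrank Fintype.card_sum fun c hc => by
      obtain ⟨s, d, hs, hd⟩ := hS (c / 2) (div_ne_zero hc two_ne_zero)
      exact ⟨2 * s, d, by simpa using hs, by linear_combination 2 * hd⟩
  set a : ι → K := fun i => b i / 2 with ha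
  have ha0 : ∀ i, a i ≠ 0 := fun i => div_ne_zero (hb i).2 two_ne_zero
  -- Replaces the coordinate vector by Σ_w X_w u_w; its Jacobian is the base change matrix of u.
  let μ : Conv (ι ⊕ τ) K →ₐ[K] Conv (ι ⊕ τ) K :=
    subst (fun z => ∑ w, u w z • X w) (fun z => by simp)
  have hμ : ∀ z w, lin w (μ (X z)) = u w z := fun z w => by
    simp only [μ, subst_X, map_sum, map_smul, lin_X, smul_eq_mul, mul_ite, mul_one, mul_zero,
      Finset.sum_ite_eq, Finset.mem_univ, if_true]
  obtain ⟨ψ, hψ⟩ := exists_algEquiv_of_isUnit_det μ (by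
    have h : (jacobian fun z => μ (X z)) = (Pi.basisFun K (ι ⊕ τ)).toMatrix u :=
      Matrix.ext fun z w => hμ z w
    rw [h]
    exact Matrix.isUnit_det_of_right_inverse
      ((Pi.basisFun K (ι ⊕ τ)).toMatrix_mul_toMatrix_flip u))
  have hX : (∑ i, a i • X (Sum.inl i) ^ 2 : Conv (ι ⊕ τ) K) ∈ maxIdeal (ι ⊕ τ) K ^ 2 :=
    Ideal.sum_mem _ fun i _ =>
      Submodule.smul_of_tower_mem _ _ (Ideal.pow_mem_pow (X_mem_maxIdeal _) 2)
  have hμf := map_mem_maxIdeal_pow μ hf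
  have h3 : μ f - ∑ i, a i • X (Sum.inl i) ^ 2 ∈ maxIdeal (ι ⊕ τ) K ^ 3 := by
    refine mem_maxIdeal_cube_of_hessian (Ideal.sub_mem _ hμf hX) ?_
    refine Matrix.ext fun z w => ?_
    rw [sub_eq_add_neg, ← neg_one_smul K (∑ i, a i • X (Sum.inl i) ^ 2 : Conv (ι ⊕ τ) K),
      hessian_add, hessian_smul, Matrix.add_apply, Matrix.smul_apply, hessian_map μ hf,
      hessian_sum_smul_sq a (fun i => valZero_X _)]
    have h4 := hu z w
    rw [Matrix.toBilin'_apply] at h4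
    have h5 : ∑ i, ∑ j, hessian f i j * (lin z (μ (X i)) * lin w (μ (X j))) =
        ∑ i, ∑ j, u z i * hessian f i j * u w j :=
      Finset.sum_congr rfl fun i _ => Finset.sum_congr rfl fun j _ => by
        rw [hμ, hμ]
        ring
    rw [h5, h4]
    rcases z with i | i <;> rcases w with j | j
    · by_cases hij : i = j
      · subst hij
        simp [ha]
        ring
      · simp [hij]
    all_goals simp [Matrix.diagonal_apply]
  obtain ⟨g, hg, hfg⟩ := exists_splitting ha0 h3
  refine ⟨a, fun i => (hb i).1, g, hg, RightEquiv.trans ⟨ψ, hψ f⟩ ?_⟩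
  rwa [add_sub_cancel] at hfg

variable {n k : ℕ}

/-- The first `k` and the last `n - k` of `n` variables. -/
def sumFin (n k : ℕ) : {i : Fin n // (i : ℕ) < k} ⊕ {i : Fin n // k ≤ (i : ℕ)} ≃ Fin n :=
  (Equiv.sumCongr (Equiv.refl _) (Equiv.subtypeEquivRight fun _ => not_lt.symm)).trans
    (Equiv.sumCompl fun i : Fin n => (i : ℕ) < k)

theorem inclEquiv_sumFin (a : {i : Fin n // (i : ℕ) < k} → K)
    (g : Conv {i : Fin n // k ≤ (i : ℕ)} K) :
    inclEquiv (sumFin n k) (∑ i, a i • X (Sum.inl i) ^ 2 + inclR g) = splitForm a g := by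
  rw [map_add, map_sum, splitForm]
  congr 1
  · refine Finset.sum_congr rfl fun i _ => ?_
    rw [map_smul, map_pow, inclEquiv_apply, incl_X]
    rfl
  · have h : (incl (sumFin n k).toEmbedding).comp inclR =
        (incl (Function.Embedding.subtype _) : Conv {i : Fin n // k ≤ (i : ℕ)} K →ₐ[K] _) := by
      refine algHom_ext fun j => ?_
      rw [AlgHom.comp_apply, inclR_X, incl_X, incl_X]
      rfl
    rw [inclEquiv_apply, ← h, AlgHom.comp_apply]

theorem exists_splitForm {f : Conv (Fin n) K} (hf : f ∈ maxIdeal (Fin n) K ^ 2)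
    (hrank : (hessian f).rank = k) {S : K → Prop}
    (hS : ∀ c : K, c ≠ 0 → ∃ s d, S s ∧ c = s * d ^ 2) :
    ∃ a : {i : Fin n // (i : ℕ) < k} → K, (∀ i, S (a i)) ∧
      ∃ g ∈ maxIdeal {i : Fin n // k ≤ (i : ℕ)} K ^ 3, RightEquiv f (splitForm a g) := by
  classical
  set e := sumFin n k
  set F := (inclEquiv e).symm f with hF
  have hF2 : F ∈ maxIdeal _ K ^ 2 := map_mem_maxIdeal_pow (inclEquiv e).symm.toAlgHom hf
  have hkn : k ≤ n := by
    rw [← hrank]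
    simpa using (hessian f).rank_le_card_width
  have hcard : Fintype.card {i : Fin n // (i : ℕ) < k} = k := by
    rw [Fintype.card_subtype, Fin.card_filter_val_lt, min_eq_right hkn]
  have hFr : (hessian F).rank = Fintype.card {i : Fin n // (i : ℕ) < k} := by
    have h : hessian F = (hessian f).submatrix e e := by
      refine Matrix.ext fun z w => ?_
      have h1 := hessian_map (inclEquiv e).symm.toAlgHom hf z w
      have h2 : ∀ i, (inclEquiv (K := K) e).symm.toAlgHom (X i) = X (e.symm i) := fun i =>
        incl_X e.symm.toEmbedding i
      simp only [h2, lin_X] at h1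
      refine h1.trans ?_
      simp [Equiv.eq_symm_apply]
    rw [h, hcard]
    exact (Matrix.rank_submatrix _ e e).trans hrank
  obtain ⟨a, ha, g, hg, hfg⟩ := exists_splitting_of_rank hF2 hFr hS
  refine ⟨a, ha, g, hg, ?_⟩
  rw [← rightEquiv_map_iff (inclEquiv e), inclEquiv_sumFin, hF, AlgEquiv.apply_symm_apply] at hfg
  exact hfg

theorem rightEquiv_of_splitForm {f : Conv (Fin n) K} {a a' : {i : Fin n // (i : ℕ) < k} → K}
    (ha' : ∀ i, a' i ≠ 0) {g g' : Conv {i : Fin n // k ≤ (i : ℕ)} K}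
    (hg : g ∈ maxIdeal _ K ^ 3) (hg' : g' ∈ maxIdeal _ K ^ 3)
    (h : RightEquiv f (splitForm a g)) (h' : RightEquiv f (splitForm a' g')) :
    RightEquiv g g' := by
  have h1 := h.symm.trans h'
  rw [← inclEquiv_sumFin, ← inclEquiv_sumFin, rightEquiv_map_iff] at h1
  exact rightEquiv_residual ha' hg hg' h1

end Splitting

end Conv

end AnalyticSplitting

end

theorem mainTheorem3 (n k : ℕ) :
    (∀ f : AnalyticSplitting.Conv (Fin n) ℂ,
      f ∈ AnalyticSplitting.Conv.maxIdeal (Fin n) ℂ ^ 2 →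
      (AnalyticSplitting.Conv.hessian f).rank = k →
      (∃ g ∈ AnalyticSplitting.Conv.maxIdeal {i : Fin n // k ≤ (i : ℕ)} ℂ ^ 3,
        AnalyticSplitting.Conv.RightEquiv f
          (AnalyticSplitting.Conv.splitForm (fun _ => 1) g)) ∧
      (∀ g ∈ AnalyticSplitting.Conv.maxIdeal {i : Fin n // k ≤ (i : ℕ)} ℂ ^ 3,
        ∀ g' ∈ AnalyticSplitting.Conv.maxIdeal {i : Fin n // k ≤ (i : ℕ)} ℂ ^ 3,
        AnalyticSplitting.Conv.RightEquiv f
          (AnalyticSplitting.Conv.splitForm (fun _ => 1) g) →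
        AnalyticSplitting.Conv.RightEquiv f
          (AnalyticSplitting.Conv.splitForm (fun _ => 1) g') →
        AnalyticSplitting.Conv.RightEquiv g g')) ∧
    (∀ f : AnalyticSplitting.Conv (Fin n) ℝ,
      f ∈ AnalyticSplitting.Conv.maxIdeal (Fin n) ℝ ^ 2 →
      (AnalyticSplitting.Conv.hessian f).rank = k →
      (∃ a : {i : Fin n // (i : ℕ) < k} → ℝ, (∀ i, a i = 1 ∨ a i = -1) ∧
        ∃ g ∈ AnalyticSplitting.Conv.maxIdeal {i : Fin n // k ≤ (i : ℕ)} ℝ ^ 3,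
          AnalyticSplitting.Conv.RightEquiv f (AnalyticSplitting.Conv.splitForm a g)) ∧
      (∀ a a' : {i : Fin n // (i : ℕ) < k} → ℝ,
        (∀ i, a i = 1 ∨ a i = -1) → (∀ i, a' i = 1 ∨ a' i = -1) →
        ∀ g ∈ AnalyticSplitting.Conv.maxIdeal {i : Fin n // k ≤ (i : ℕ)} ℝ ^ 3,
        ∀ g' ∈ AnalyticSplitting.Conv.maxIdeal {i : Fin n // k ≤ (i : ℕ)} ℝ ^ 3,
        AnalyticSplitting.Conv.RightEquiv f (AnalyticSplitting.Conv.splitForm a g) →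
        AnalyticSplitting.Conv.RightEquiv f (AnalyticSplitting.Conv.splitForm a' g') →
        AnalyticSplitting.Conv.RightEquiv g g')) := by
  refine ⟨fun f hf hrank => ⟨?_, fun g hg g' hg' h h' => ?_⟩,
    fun f hf hrank => ⟨?_, fun a a' _ ha' g hg g' hg' h h' => ?_⟩⟩
  · obtain ⟨a, ha, g, hg, h⟩ := AnalyticSplitting.Conv.exists_splitForm hf hrank
      (S := fun s => s = 1) fun c _ => by
        obtain ⟨d, hd⟩ := IsAlgClosed.exists_pow_nat_eq c two_pos
        exact ⟨1, d, rfl, by rw [hd, one_mul]⟩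
    obtain rfl : a = fun _ => 1 := funext ha
    exact ⟨g, hg, h⟩
  · exact AnalyticSplitting.Conv.rightEquiv_of_splitForm (fun _ => one_ne_zero) hg hg' h h'
  · refine AnalyticSplitting.Conv.exists_splitForm hf hrank
      (S := fun s => s = 1 ∨ s = -1) fun c _ => ?_
    rcases le_total 0 c with hc | hc
    · exact ⟨1, √c, Or.inl rfl, by rw [Real.sq_sqrt hc, one_mul]⟩
    · exact ⟨-1, √(-c), Or.inr rfl, by rw [Real.sq_sqrt (neg_nonneg.mpr hc)]; ring⟩
  · refine AnalyticSplitting.Conv.rightEquiv_of_splitForm (fun i => ?_) hg hg' h h'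
    rcases ha' i with hi | hi <;> rw [hi] <;> norm_num
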